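/- There is exactly one sequence $(G_r)_{r\ge 0}$ of meromorphic functions on $\mathbb{C}$ (Vignéras' multiple gamma functions) such that, for all $r\ge 0$: (i) $G_0(z)=z$; (ii) $G_r(1)=1$; (iii) $G_{r+1}(z+1)=G_r(z)\,G_{r+1}(z)$ as meromorphic functions; (iv) $G_r$ is regular, real and positive on $[1,\infty)$, and $\frac{d^{r+1}}{dx^{r+1}}\log G_r(x+1)\ge 0$ for all real $x\ge 0$. Write $\binom{z}{k}=\frac{z(z-1)\cdots(z-k+1)}{k!}$, and let powers of positive real numbers be taken with the real logarithm. For every integer $r\ge 1$ and every $z\in\mathbb{C}$ that is not a negative integer, $$G_r(z+1)=\lim_{N\to\infty}\left[\prod_{n=1}^{N}\frac{G_{r-1}(n)}{G_{r-1}(z+n)}\ \prod_{k=0}^{r-1}G_k(N+1)^{\binom{z}{r-k}}\right]$$ and $$G_r(z+1)=\prod_{n=1}^{\infty}\left[\frac{G_{r-1}(n)}{G_{r-1}(z+n)}\ \prod_{k=0}^{r-1}\left(\frac{G_k(n+1)}{G_k(n)}\right)^{\binom{z}{r-k}}\right],$$ where the infinite product converges independently of the order of its factors. In both formulas the convergence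 is uniform for $z$ in any compact subset of $\mathbb{C}\setminus\{-1,-2,-3,\dots\}$. For $r=1$ one has $G_1=\Gamma$, and the formulas are the classical products of Gauss and Euler: for $z$ not a negative integer, the expression in the first bracket equals $\frac{N!}{(z+1)\cdots(z+N)}(N+1)^z$ for every $N\ge 0$, and the expression in the second bracket equals $\left(1+\frac zn\right)^{-1}\left(1+\frac1n\right)^z$ for every $n\ge 1$. -/

import Mathlib

open Filter Topology

/-- `G 0, G 1, G 2, …` is Vignéras' sequence of multiple gamma functions: meromorphic functions on
`ℂ` satisfying the generalised Bohr–Mollerup conditions.  A meromorphic function is represented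
by its normal form (analytic off its poles, value `0` at each pole), so that it is determined
everywhere; the functional equation is an identity of meromorphic functions. -/
structure IsMultipleGammaSeq (G : ℕ → ℂ → ℂ) : Prop where
  meromorphic : ∀ r, MeromorphicNFOn (G r) Set.univ
  zero : ∀ z, G 0 z = z
  one : ∀ r, G r 1 = 1
  functional_eq : ∀ r,
    (fun z ↦ G (r + 1) (z + 1)) =ᶠ[codiscrete ℂ] (fun z ↦ G r z * G (r + 1) z)
  /-- `G r` takes positive real values on `[1, ∞)`, so that `log G r (x + 1)` is defined. -/
  pos : ∀ r, ∀ x : ℝ, 0 ≤ x → 0 < (G r (x + 1)).re ∧ (G r (x + 1)).im = 0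
  iteratedDeriv_log_nonneg : ∀ r, ∀ x : ℝ, 0 ≤ x →
    0 ≤ iteratedDeriv (r + 1) (fun t : ℝ ↦ Real.log (G r (t + 1)).re) x

/-- The complex plane without the negative integers. -/
def offNegInt : Set ℂ := {z | ∀ m : ℕ, 1 ≤ m → z ≠ -(m : ℂ)}

/-- The `N`-th term of the Gauss-type sequence of order `r ≥ 1`,
`∏_{n=1}^N G_{r-1}(n) / G_{r-1}(z+n) · ∏_{k=0}^{r-1} G_k(N+1)^{binom(z, r-k)}`. -/
noncomputable def gaussTerm (G : ℕ → ℂ → ℂ) (r N : ℕ) (z : ℂ) : ℂ :=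
  (∏ n ∈ Finset.Icc 1 N, G (r - 1) n / G (r - 1) (z + n)) *
    ∏ k ∈ Finset.range r, G k (N + 1) ^ Ring.choose z (r - k)

/-- The `n`-th factor (`n ≥ 1`) of the Euler-type product of order `r ≥ 1`,
`G_{r-1}(n) / G_{r-1}(z+n) · ∏_{k=0}^{r-1} (G_k(n+1) / G_k(n))^{binom(z, r-k)}`. -/
noncomputable def eulerFactor (G : ℕ → ℂ → ℂ) (r n : ℕ) (z : ℂ) : ℂ :=
  G (r - 1) n / G (r - 1) (z + n) *
    ∏ k ∈ Finset.range r, (G k (n + 1) / G k n) ^ Ring.choose z (r - k)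

/-! Everything is carried by the Newton interpolation remainder `newtonRem f d M z`, with nodes M,
..., M + d. Two identities govern it. Differencing in z lowers the degree by one (Pascal's rule,
`newtonRem_add_one`), and replacing f by its forward difference gives the increment in M
(`newtonRem_fwdDiff`). Hence, up to sign, the sum over M of the remainders of degree s + 1 solves
F(z + 1) - F(z) = f(z) by telescoping.

Starting from log(1 + z), whose degree-d remainder at base N is O(N^(-d-1)) by Taylor's formula,
each such summation costs one power of N (`IsLogGammaLike.diffPrimitive`). Thus after s summations
degree s + 1 still leaves a summable O(N^(-2)), and the construction can be iterated to give the
logarithms of all G_s(z + 1) on Re z > -1. Termwise differentiation preserves the alternation of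
signs behind condition (iv), and division by shifted values of G_s continues the exponentials
meromorphically.

The Newton coefficients of log G_r(z + 1) at N are the numbers log G_k(N + 1), k ≤ r. So the Gauss
expression is G_r(z + 1) times the exponential of minus a remainder tending to zero, and the Euler
factors are the exponentials of minus the summable remainders of the preceding level.

For uniqueness, two candidates for G_{r+1} have a 1-periodic difference of logarithms on the real
line. Monotonicity traps the derivative of order r + 1 of both logarithms between shifts of log(x +
1), whose increments tend to zero; so that derivative of the difference vanishes, and periodicity
makes the difference constant. -/

/-! ### Newton interpolation remainders -/

open Polynomial in
theorem exists_polynomial_ringChoose (j : ℕ) :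
    ∃ p : ℂ[X], p.natDegree ≤ j ∧ ∀ z : ℂ, Ring.choose z j = p.eval z := by
  refine ⟨C ((j.factorial : ℂ)⁻¹) * (descPochhammer ℤ j).map (Int.castRingHom ℂ), ?_, fun z ↦ ?_⟩
  · refine (natDegree_C_mul_le _ _).trans (natDegree_map_le.trans ?_)
    rw [descPochhammer_natDegree]
  · rw [Ring.choose_eq_smul, eval_mul, eval_C, smul_eq_mul, eval_map,
      ← eval₂_smulOneHom_eq_smeval, Subsingleton.elim RingHom.smulOneHom (Int.castRingHom ℂ)]

theorem continuous_ringChoose (j : ℕ) : Continuous fun z : ℂ ↦ Ring.choose z j := by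
  obtain ⟨p, -, hp⟩ := exists_polynomial_ringChoose j
  simpa only [hp] using p.continuous

theorem differentiable_ringChoose (j : ℕ) : Differentiable ℂ fun z : ℂ ↦ Ring.choose z j := by
  obtain ⟨p, -, hp⟩ := exists_polynomial_ringChoose j
  simpa only [hp] using p.differentiable

/-- The error at `z + M` of the Newton interpolation of `f` of degree `d` with nodes
`M, M + 1, …, M + d`. -/
noncomputable def newtonRem (f : ℂ → ℂ) (d M : ℕ) (z : ℂ) : ℂ :=
  f (z + M) - ∑ j ∈ Finset.range (d + 1), Ring.choose z j * (fwdDiff 1)^[j] f M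

/-- Differencing commutes with the Newton coefficients, so remainders of a difference telescope in
the base point. -/
theorem newtonRem_fwdDiff (f : ℂ → ℂ) (d M : ℕ) (z : ℂ) :
    newtonRem (fwdDiff 1 f) d M z = newtonRem f d (M + 1) z - newtonRem f d M z := by
  have h (j : ℕ) : (fwdDiff 1)^[j] (fwdDiff 1 f) (M : ℂ) =
      (fwdDiff 1)^[j] f ((M + 1 : ℕ) : ℂ) - (fwdDiff 1)^[j] f (M : ℂ) := by
    rw [← Function.iterate_succ_apply, Function.iterate_succ_apply', fwdDiff]
    push_cast; rfl
  simp only [newtonRem, h, mul_sub, Finset.sum_sub_distrib]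
  simp only [fwdDiff]
  push_cast
  ring_nf

/-- Pascal's rule shifts each binomial coefficient down by one; the constant term cancels. -/
theorem newtonRem_add_one (f : ℂ → ℂ) (d M : ℕ) (z : ℂ) :
    newtonRem f (d + 1) M (z + 1) - newtonRem f (d + 1) M z = newtonRem (fwdDiff 1 f) d M z := by
  simp only [newtonRem]
  rw [Finset.sum_range_succ' _ (d + 1), Finset.sum_range_succ' _ (d + 1)]
  simp only [Ring.choose_succ_succ, add_mul, Finset.sum_add_distrib, Ring.choose_zero_right,
    ← Function.iterate_succ_apply]
  simp only [fwdDiff, Function.iterate_zero_apply]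
  rw [add_right_comm z 1]
  ring

theorem newtonRem_zero_right (f : ℂ → ℂ) (d M : ℕ) : newtonRem f d M 0 = 0 := by
  rw [newtonRem, Finset.sum_range_succ', Finset.sum_eq_zero]
  · simp
  · intro j _
    rw [Ring.choose_zero_succ, zero_mul]

theorem newtonRem_add (f g : ℂ → ℂ) (d M : ℕ) (z : ℂ) :
    newtonRem (f + g) d M z = newtonRem f d M z + newtonRem g d M z := by
  simp only [newtonRem, fwdDiff_iter_add, Pi.add_apply, mul_add, Finset.sum_add_distrib]
  ring

theorem newtonRem_comp_add (f : ℂ → ℂ) (d M : ℕ) (z : ℂ) :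
    newtonRem (fun u ↦ f (u + M)) d 0 z = newtonRem f d M z := by
  simp [newtonRem, fwdDiff_iter_comp_add]

theorem norm_fwdDiff_iterate_le {f : ℂ → ℂ} {ε : ℝ} (j n : ℕ)
    (h : ∀ i : ℕ, i ≤ n + j → ‖f i‖ ≤ ε) : ‖(fwdDiff 1)^[j] f (n : ℂ)‖ ≤ 2 ^ j * ε := by
  induction j generalizing n with
  | zero => simpa using h n (by omega)
  | succ j ih =>
    rw [Function.iterate_succ_apply', fwdDiff]
    have h1 := ih (n + 1) (fun i hi ↦ h i (by omega))
    have h2 := ih n (fun i hi ↦ h i (by omega))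
    push_cast at h1
    calc _ ≤ _ := norm_sub_le _ _
      _ ≤ 2 ^ j * ε + 2 ^ j * ε := add_le_add h1 h2
      _ = _ := by ring

theorem norm_newtonRem_le {f : ℂ → ℂ} {ε : ℝ} (d : ℕ) {z : ℂ} (hz : ‖f z‖ ≤ ε)
    (h : ∀ i : ℕ, i ≤ d → ‖f i‖ ≤ ε) :
    ‖newtonRem f d 0 z‖ ≤
      (1 + ∑ j ∈ Finset.range (d + 1), ‖(Ring.choose z j : ℂ)‖ * 2 ^ j) * ε := by
  have h' (j : ℕ) (hj : j ∈ Finset.range (d + 1)) :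
      ‖Ring.choose z j * (fwdDiff 1)^[j] f (0 : ℕ)‖ ≤ ‖(Ring.choose z j : ℂ)‖ * 2 ^ j * ε := by
    rw [norm_mul, mul_assoc]
    refine mul_le_mul_of_nonneg_left (norm_fwdDiff_iterate_le j 0 fun i hi ↦ h i ?_)
      (norm_nonneg _)
    simp only [Finset.mem_range] at hj
    omega
  rw [newtonRem, add_mul, one_mul, Finset.sum_mul]
  refine (norm_sub_le _ _).trans (add_le_add (by simpa using hz) ?_)
  exact norm_sum_le_of_le _ h'

-- Newton's forward formula makes p agree with its interpolation polynomial at every natural number,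
-- hence identically.
open Polynomial in
theorem newtonRem_polynomial {p : ℂ[X]} {d : ℕ} (hp : p.natDegree ≤ d) (z : ℂ) :
    newtonRem p.eval d 0 z = 0 := by
  choose c hcd hc using exists_polynomial_ringChoose
  let q : ℂ[X] := ∑ j ∈ Finset.range (d + 1), c j * C ((fwdDiff 1)^[j] p.eval 0)
  have hq (z : ℂ) : newtonRem p.eval d 0 z = p.eval z - q.eval z := by
    simp [newtonRem, q, hc, eval_finsetSum]
  suffices p = q by rw [hq, ← this, sub_self]
  refine eq_of_infinite_eval_eq p q
    ((Set.infinite_range_of_injective Nat.cast_injective).mono (s := Set.range ((↑) : ℕ → ℂ)) ?_)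
  rintro _ ⟨n, rfl⟩
  rw [Set.mem_ofPred_eq, ← sub_eq_zero, ← hq, newtonRem, sub_eq_zero]
  have h := shift_eq_sum_fwdDiff_iter (1 : ℂ) p.eval n 0
  rw [zero_add, nsmul_one] at h
  have e1 : ∀ j ∉ Finset.range (d + 1), (fwdDiff 1)^[j] p.eval (0 : ℂ) = 0 := fun j hj ↦ by
    rw [fwdDiff_iter_eq_zero_of_degree_lt]
    · rfl
    · simp only [Finset.mem_range] at hj
      omega
  simp only [Nat.cast_zero, add_zero, Ring.choose_natCast]
  rw [h]
  simp only [nsmul_eq_mul]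
  trans ∑ j ∈ Finset.range (d + 1 + n), (n.choose j : ℂ) * (fwdDiff 1)^[j] p.eval (0 : ℂ)
  · refine Finset.sum_subset (fun j hj ↦ ?_) fun j _ hj ↦ ?_
    · simp only [Finset.mem_range] at *
      omega
    · rw [Nat.choose_eq_zero_of_lt, Nat.cast_zero, zero_mul]
      simp only [Finset.mem_range] at *
      omega
  · refine (Finset.sum_subset (fun j hj ↦ ?_) fun j _ hj ↦ ?_).symm
    · simp only [Finset.mem_range] at *
      omega
    · rw [e1 j hj, mul_zero]

/-! ### Decay of the remainders -/

/-- The errors of Newton interpolation of degree `d` are `O(N ^ (-p))`, locally uniformly. -/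
def NewtonDecay (f : ℂ → ℂ) (d p : ℕ) : Prop :=
  ∀ K : ℝ, ∃ C : ℝ, ∃ N₀ : ℕ, ∀ N ≥ N₀, ∀ z : ℂ, ‖z‖ ≤ K →
    ‖newtonRem f d N z‖ ≤ C / ((N : ℝ) + 1) ^ p

/-- Interpolation reproduces the degree-d Taylor polynomial of the logarithm at N + 1 exactly, so
only the Taylor error, of order N^(-d-1) at z and at the nodes, contributes. -/
theorem newtonDecay_log (d : ℕ) : NewtonDecay (fun z ↦ Complex.log (1 + z)) d (d + 1) := by
  intro K
  obtain ⟨B, hB⟩ := (isCompact_closedBall (0 : ℂ) K).exists_bound_of_continuousOn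
    (f := fun z : ℂ ↦ 1 + ∑ j ∈ Finset.range (d + 1), ‖(Ring.choose z j : ℂ)‖ * 2 ^ j)
    (continuous_const.add (continuous_finsetSum _ fun j _ ↦
      (continuous_ringChoose j).norm.mul continuous_const)).continuousOn
  -- One disc has to contain both z and the nodes 0, ..., d; the choice of N₀ then keeps |u / x| ≤
  -- 1/2 on it.
  set K' : ℝ := max K d with hK'
  have hK'0 : 0 ≤ K' := le_max_of_le_right (by positivity)
  obtain ⟨N₀, hN₀⟩ := exists_nat_ge (2 * K')
  refine ⟨B * (2 * K' ^ (d + 1)), N₀, fun N hN z hz ↦ ?_⟩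
  set x : ℝ := (N : ℝ) + 1 with hx
  have hNN : (N₀ : ℝ) ≤ N := by exact_mod_cast hN
  have hx0 : 0 < x := by positivity
  have hxK : 2 * K' ≤ x := by linarith
  let p : Polynomial ℂ := Polynomial.C (Complex.log x) + ∑ j ∈ Finset.range (d + 1),
    Polynomial.C ((-1) ^ (j + 1) / (j * (x : ℂ) ^ j)) * Polynomial.X ^ j
  have hpd : p.natDegree ≤ d := by
    refine Polynomial.natDegree_add_le_of_degree_le (by simp)
      (Polynomial.natDegree_sum_le_of_forall_le _ _ fun j hj ↦ ?_)
    refine (Polynomial.natDegree_C_mul_X_pow_le _ _).trans ?_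
    simp only [Finset.mem_range] at hj
    omega
  have hp (u : ℂ) : p.eval u = Complex.log x + Complex.logTaylor (d + 1) (u / x) := by
    simp only [p, Complex.logTaylor, Polynomial.eval_add, Polynomial.eval_C,
      Polynomial.eval_finsetSum, Polynomial.eval_mul, Polynomial.eval_pow, Polynomial.eval_X]
    congr 1
    refine Finset.sum_congr rfl fun j _ ↦ ?_
    rw [div_pow]
    ring
  let E : ℂ → ℂ := fun u ↦ Complex.log (1 + (u + N)) - p.eval u
  have hE (u : ℂ) (hu : ‖u‖ ≤ K') : ‖E u‖ ≤ 2 * K' ^ (d + 1) / x ^ (d + 1) := by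
    have hux : ‖u / x‖ ≤ K' / x := by
      rw [norm_div, Complex.norm_real, Real.norm_of_nonneg hx0.le]
      gcongr
    have hux2 : K' / x ≤ 1 / 2 := by
      rw [div_le_iff₀ hx0]; linarith
    have hne : 1 + u / x ≠ 0 := fun h ↦ by
      have : u / x = -1 := by linear_combination h
      rw [this] at hux
      norm_num at hux
      linarith
    have hlog : Complex.log (1 + (u + N)) = Complex.log x + Complex.log (1 + u / x) := by
      have hxc : (x : ℂ) ≠ 0 := by exact_mod_cast hx0.ne'
      rw [← Complex.ofReal_log hx0.le, ← Complex.log_ofReal_mul hx0 hne, mul_add,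
        mul_div_cancel₀ _ hxc, hx]
      push_cast
      ring_nf
    have hE' : E u = Complex.log (1 + u / x) - Complex.logTaylor (d + 1) (u / x) := by
      simp only [E, hp, hlog]; ring
    rw [hE']
    refine (Complex.norm_log_sub_logTaylor_le d (by linarith)).trans ?_
    have h1 : (1 - ‖u / x‖)⁻¹ ≤ 2 := by
      rw [inv_le_comm₀ (by linarith) (by norm_num)]
      linarith
    have h2 : ‖u / x‖ ^ (d + 1) ≤ (K' / x) ^ (d + 1) := by gcongr
    calc _ ≤ ‖u / x‖ ^ (d + 1) * (1 - ‖u / x‖)⁻¹ := by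
          refine div_le_self (mul_nonneg (by positivity) (inv_nonneg.2 (by linarith))) ?_
          have : (0 : ℝ) ≤ d := by positivity
          linarith
      _ ≤ (K' / x) ^ (d + 1) * 2 := mul_le_mul h2 h1 (inv_nonneg.2 (by linarith)) (by positivity)
      _ = _ := by rw [div_pow]; ring
  have hdec : newtonRem (fun z ↦ Complex.log (1 + z)) d N z = newtonRem E d 0 z := by
    have : (fun u : ℂ ↦ Complex.log (1 + (u + N))) = E + p.eval := by
      funext u; simp [E]
    rw [← newtonRem_comp_add (fun z ↦ Complex.log (1 + z)), this, newtonRem_add,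
      newtonRem_polynomial hpd, add_zero]
  rw [hdec]
  refine (norm_newtonRem_le d (hE z (hz.trans (le_max_left _ _))) fun i hi ↦ hE i ?_).trans ?_
  · rw [Complex.norm_natCast]
    exact le_max_of_le_right (by exact_mod_cast hi)
  · rw [mul_div_assoc B]
    refine mul_le_mul_of_nonneg_right ?_ (by positivity)
    exact (Real.le_norm_self _).trans (hB z (by simpa using hz))

/-- A null sequence is bounded by the tail sum of its increments, which loses one power of N. -/
theorem norm_le_of_norm_sub_le_of_tendsto_zero {a : ℕ → ℂ} {C : ℝ} {p N₀ : ℕ}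
    (h : ∀ N ≥ N₀, ‖a (N + 1) - a N‖ ≤ C / ((N : ℝ) + 1) ^ (p + 2))
    (ha : Tendsto a atTop (𝓝 0)) {N : ℕ} (hN : N₀ ≤ N) :
    ‖a N‖ ≤ 2 * C / ((N : ℝ) + 1) ^ (p + 1) := by
  have hC : 0 ≤ C := by
    have := (norm_nonneg _).trans (h N₀ le_rfl)
    by_contra! hC
    exact absurd this (not_le.2 (div_neg_of_neg_of_pos hC (by positivity)))
  -- A telescoping majorant of the tail; the factor 2 absorbs x + 1 ≤ 2x.
  let b : ℕ → ℝ := fun N ↦ 2 * C / ((N : ℝ) + 1) ^ (p + 1)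
  have hb0 (N : ℕ) : 0 ≤ b N := by positivity
  have hb (N : ℕ) : C / ((N : ℝ) + 1) ^ (p + 2) ≤ b N - b (N + 1) := by
    simp only [b]
    push_cast
    set x : ℝ := (N : ℝ) + 1 with hx
    have hx1 : 1 ≤ x := by simp [hx]
    have hx0 : 0 < x := by positivity
    have h1 : x ^ p ≤ (x + 1) ^ p := by gcongr; linarith
    have h2 : 1 / (x + 1) ^ (p + 1) ≤ 1 / (x ^ p * (x + 1)) := by
      rw [pow_succ]; gcongr
    have h3 : 1 / x ^ (p + 2) ≤ 2 * (1 / x ^ (p + 1) - 1 / (x ^ p * (x + 1))) := by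
      have : 2 * (1 / x ^ (p + 1) - 1 / (x ^ p * (x + 1))) = 2 / (x ^ (p + 1) * (x + 1)) := by
        field_simp
        ring
      rw [this, div_le_div_iff₀ (by positivity) (by positivity)]
      have : 0 < x ^ p := by positivity
      have e : x ^ (p + 1) = x ^ p * x := pow_succ _ _
      have e2 : x ^ (p + 2) = x ^ p * x * x := by ring
      rw [e, e2]
      have : x ^ p * x * (x + 1) ≤ x ^ p * x * (2 * x) := by gcongr; linarith
      linarith
    calc C / x ^ (p + 2) = C * (1 / x ^ (p + 2)) := by ring
      _ ≤ C * (2 * (1 / x ^ (p + 1) - 1 / (x + 1) ^ (p + 1))) := by gcongr; linarith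
      _ = _ := by ring
  have key (k : ℕ) : ‖a N‖ ≤ ‖a (N + k)‖ + (b N - b (N + k)) := by
    induction k with
    | zero => simp
    | succ k ih =>
      have h1 := h (N + k) (by omega)
      have h2 := hb (N + k)
      have h3 := norm_sub_norm_le (a (N + k)) (a (N + k + 1))
      rw [norm_sub_rev] at h3
      rw [← add_assoc]
      linarith
  have hlim : Tendsto (fun k ↦ ‖a (N + k)‖ + b N) atTop (𝓝 (0 + b N)) := by
    have h := (ha.comp (tendsto_add_atTop_nat N)).norm.add_const (b N)
    simpa [Function.comp_def, add_comm] using h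
  rw [zero_add] at hlim
  exact ge_of_tendsto' hlim fun k ↦ (key k).trans (by linarith [hb0 (N + k)])

/-! ### Solving the difference equation -/

/-- The half-plane on which the logarithms of the shifted multiple gamma functions live. -/
def rightHalfPlane : Set ℂ := {z | -1 < z.re}

theorem isOpen_rightHalfPlane : IsOpen rightHalfPlane :=
  isOpen_lt continuous_const Complex.continuous_re

theorem add_natCast_mem_rightHalfPlane {z : ℂ} (hz : z ∈ rightHalfPlane) (n : ℕ) :
    z + n ∈ rightHalfPlane := by
  simp only [rightHalfPlane, Set.mem_ofPred_eq, Complex.add_re, Complex.natCast_re] at hz ⊢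
  have : (0 : ℝ) ≤ n := n.cast_nonneg
  linarith

/-- `f` behaves like the logarithm of `G s (z + 1)`. -/
structure IsLogGammaLike (s : ℕ) (f : ℂ → ℂ) : Prop where
  differentiableOn : DifferentiableOn ℂ f rightHalfPlane
  decay : ∀ d ≥ s, NewtonDecay f d (d + 1 - s)
  fwdDiff_zero : ∀ j ≤ s, (fwdDiff 1)^[j] f 0 = 0
  tendsto_fwdDiff : ∀ j > s, Tendsto (fun N : ℕ ↦ (fwdDiff 1)^[j] f (N : ℂ)) atTop (𝓝 0)

/-- The solution `F` of `F (z + 1) - F z = f z` with the least growth and `F 0 = 0`. -/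
noncomputable def diffPrimitive (s : ℕ) (f : ℂ → ℂ) (z : ℂ) : ℂ :=
  -∑' M : ℕ, newtonRem f (s + 1) M z

theorem summable_const_div_natCast_add_one_sq (C : ℝ) :
    Summable fun n : ℕ ↦ C / ((n : ℝ) + 1) ^ 2 := by
  have h := (summable_nat_add_iff 1).2 (Real.summable_one_div_nat_pow.2 one_lt_two)
  simpa [div_eq_mul_inv] using h.mul_left C

namespace IsLogGammaLike

variable {s : ℕ} {f : ℂ → ℂ}

/-- Degree s gives only the exponent 1; degree s + 1 gives the exponent 2, which is summable. -/
theorem exists_norm_newtonRem_le (hf : IsLogGammaLike s f) (K : ℝ) :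
    ∃ u : ℕ → ℝ, Summable u ∧
      ∀ᶠ M in atTop, ∀ z : ℂ, ‖z‖ ≤ K → ‖newtonRem f (s + 1) M z‖ ≤ u M := by
  obtain ⟨C, N₀, h⟩ := hf.decay (s + 1) (by omega) K
  rw [show s + 1 + 1 - s = 2 by omega] at h
  exact ⟨_, summable_const_div_natCast_add_one_sq C, eventually_atTop.2 ⟨N₀, h⟩⟩

theorem hasSum_newtonRem (hf : IsLogGammaLike s f) (z : ℂ) :
    HasSum (fun M ↦ newtonRem f (s + 1) M z) (-diffPrimitive s f z) := by
  obtain ⟨u, hu, h⟩ := hf.exists_norm_newtonRem_le ‖z‖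
  rw [diffPrimitive, neg_neg]
  refine (hu.of_norm_bounded_eventually (g := u) ?_).hasSum
  rw [Nat.cofinite_eq_atTop]
  exact h.mono fun M hM ↦ hM z le_rfl

theorem tendsto_newtonRem (hf : IsLogGammaLike s f) {d : ℕ} (hd : s ≤ d) (z : ℂ) :
    Tendsto (fun N ↦ newtonRem f d N z) atTop (𝓝 0) := by
  obtain ⟨C, N₀, h⟩ := hf.decay d hd ‖z‖
  refine squeeze_zero_norm' (a := fun N : ℕ ↦ C / ((N : ℝ) + 1) ^ (d + 1 - s))
    (eventually_atTop.2 ⟨N₀, fun N hN ↦ h N hN z le_rfl⟩) ?_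
  refine Tendsto.div_atTop tendsto_const_nhds ?_
  exact (tendsto_pow_atTop (by omega)).comp
    (tendsto_atTop_add_const_right _ _ tendsto_natCast_atTop_atTop)

theorem newtonRem_self_zero (hf : IsLogGammaLike s f) (z : ℂ) : newtonRem f s 0 z = f z := by
  rw [newtonRem, Finset.sum_eq_zero]
  · simp
  · intro j hj
    rw [Nat.cast_zero, hf.fwdDiff_zero j (Nat.lt_succ_iff.1 (Finset.mem_range.1 hj)), mul_zero]

/-- The two difference identities turn the sum into one telescoping in M. Its upper end tends to
zero; its lower end is f(z), because the differences of f at 0 vanish up to order s. -/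
theorem fwdDiff_diffPrimitive (hf : IsLogGammaLike s f) : fwdDiff 1 (diffPrimitive s f) = f := by
  funext z
  have h1 := ((hf.hasSum_newtonRem (z + 1)).sub (hf.hasSum_newtonRem z)).tendsto_sum_nat
  have h2 (N : ℕ) : ∑ M ∈ Finset.range N,
      (newtonRem f (s + 1) M (z + 1) - newtonRem f (s + 1) M z) =
      newtonRem f s N z - f z := by
    rw [← hf.newtonRem_self_zero z, ← Finset.sum_range_sub (fun M ↦ newtonRem f s M z)]
    exact Finset.sum_congr rfl fun M _ ↦ by rw [newtonRem_add_one, newtonRem_fwdDiff]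
  simp only [h2] at h1
  have h3 := (hf.tendsto_newtonRem le_rfl z).sub_const (f z)
  have h4 := tendsto_nhds_unique h1 h3
  rw [fwdDiff]
  linear_combination -h4

theorem diffPrimitive_zero (s : ℕ) (f : ℂ → ℂ) : diffPrimitive s f 0 = 0 := by
  simp [diffPrimitive, newtonRem_zero_right]

theorem summableLocallyUniformlyOn (hf : IsLogGammaLike s f) :
    SummableLocallyUniformlyOn (fun M ↦ newtonRem f (s + 1) M) rightHalfPlane := by
  refine SummableLocallyUniformlyOn.of_locally_bounded_eventually isOpen_rightHalfPlane
    fun K _ hK ↦ ?_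
  obtain ⟨R, hR⟩ := hK.isBounded.exists_norm_le
  obtain ⟨u, hu, h⟩ := hf.exists_norm_newtonRem_le R
  refine ⟨u, hu, ?_⟩
  rw [Nat.cofinite_eq_atTop]
  exact h.mono fun M hM z hz ↦ hM z (hR z hz)

theorem differentiableAt_newtonRem (hf : IsLogGammaLike s f) (d M : ℕ) {z : ℂ}
    (hz : z ∈ rightHalfPlane) : DifferentiableAt ℂ (newtonRem f d M) z := by
  have h1 : DifferentiableAt ℂ f (z + M) := (hf.differentiableOn _
    (add_natCast_mem_rightHalfPlane hz M)).differentiableAt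
    (isOpen_rightHalfPlane.mem_nhds (add_natCast_mem_rightHalfPlane hz M))
  refine DifferentiableAt.sub (differentiableAt_comp_add_const.2 h1) ?_
  exact DifferentiableAt.fun_sum fun j _ ↦ (differentiable_ringChoose j z).mul_const _

theorem fwdDiff_iterate_diffPrimitive (hf : IsLogGammaLike s f) (j : ℕ) :
    (fwdDiff 1)^[j + 1] (diffPrimitive s f) = (fwdDiff 1)^[j] f := by
  rw [Function.iterate_succ_apply, hf.fwdDiff_diffPrimitive]

theorem fwdDiff_iterate_diffPrimitive_zero (hf : IsLogGammaLike s f) {j : ℕ} (hj : j ≤ s + 1) :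
    (fwdDiff 1)^[j] (diffPrimitive s f) 0 = 0 := by
  cases j with
  | zero => exact diffPrimitive_zero s f
  | succ j => rw [hf.fwdDiff_iterate_diffPrimitive, hf.fwdDiff_zero j (by omega)]

theorem tendsto_fwdDiff_iterate_diffPrimitive (hf : IsLogGammaLike s f) {j : ℕ} (hj : s + 1 < j) :
    Tendsto (fun N : ℕ ↦ (fwdDiff 1)^[j] (diffPrimitive s f) (N : ℂ)) atTop (𝓝 0) := by
  obtain ⟨j, rfl⟩ : ∃ i, j = i + 1 := ⟨j - 1, by omega⟩
  rw [hf.fwdDiff_iterate_diffPrimitive]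
  exact hf.tendsto_fwdDiff j (by omega)

/-- In degree s + 1 the remainder at N is minus the tail of the defining series. Each further degree
subtracts one Newton term, which tends to zero. -/
theorem tendsto_newtonRem_diffPrimitive (hf : IsLogGammaLike s f) {d : ℕ} (hd : s + 1 ≤ d)
    (z : ℂ) : Tendsto (fun N ↦ newtonRem (diffPrimitive s f) d N z) atTop (𝓝 0) := by
  induction d, hd using Nat.le_induction with
  | base =>
    have h0 : newtonRem (diffPrimitive s f) (s + 1) 0 z = diffPrimitive s f z := by
      rw [newtonRem, Finset.sum_eq_zero]
      · simp
      · intro j hj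
        rw [Nat.cast_zero, hf.fwdDiff_iterate_diffPrimitive_zero
          (Nat.lt_succ_iff.1 (Finset.mem_range.1 hj)), mul_zero]
    have h1 (N : ℕ) : newtonRem (diffPrimitive s f) (s + 1) N z =
        diffPrimitive s f z + ∑ M ∈ Finset.range N, newtonRem f (s + 1) M z := by
      nth_rw 3 [← hf.fwdDiff_diffPrimitive]
      simp only [newtonRem_fwdDiff]
      rw [Finset.sum_range_sub (fun M ↦ newtonRem (diffPrimitive s f) (s + 1) M z), h0]
      ring
    simp only [h1]
    simpa using (hf.hasSum_newtonRem z).tendsto_sum_nat.const_add (diffPrimitive s f z)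
  | succ d hd ih =>
    have h1 (N : ℕ) : newtonRem (diffPrimitive s f) (d + 1) N z =
        newtonRem (diffPrimitive s f) d N z -
          Ring.choose z (d + 1) * (fwdDiff 1)^[d + 1] (diffPrimitive s f) N := by
      rw [newtonRem, Finset.sum_range_succ, newtonRem]
      ring
    simp only [h1]
    simpa using ih.sub ((hf.tendsto_fwdDiff_iterate_diffPrimitive
      (j := d + 1) (by omega)).const_mul (Ring.choose z (d + 1)))

/-- The remainder of the primitive tends to zero and its increments in N are remainders of f, so its
decay comes from summing back from infinity. -/
theorem diffPrimitive (hf : IsLogGammaLike s f) : IsLogGammaLike (s + 1) (diffPrimitive s f) where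
  differentiableOn := (hf.summableLocallyUniformlyOn.differentiableOn isOpen_rightHalfPlane
    fun M _ hz ↦ hf.differentiableAt_newtonRem _ M hz).neg
  decay d hd K := by
    obtain ⟨C, N₀, h⟩ := hf.decay d (by omega) K
    refine ⟨2 * C, N₀, fun N hN z hz ↦ ?_⟩
    rw [show d + 1 - (s + 1) = d - s - 1 + 1 by omega]
    refine norm_le_of_norm_sub_le_of_tendsto_zero
      (a := fun N ↦ newtonRem (_root_.diffPrimitive s f) d N z) (N₀ := N₀) (fun N hN ↦ ?_)
      (hf.tendsto_newtonRem_diffPrimitive hd z) hN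
    rw [← newtonRem_fwdDiff, hf.fwdDiff_diffPrimitive, show d - s - 1 + 2 = d + 1 - s by omega]
    exact h N hN z hz
  fwdDiff_zero _ hj := hf.fwdDiff_iterate_diffPrimitive_zero hj
  tendsto_fwdDiff _ hj := hf.tendsto_fwdDiff_iterate_diffPrimitive hj

end IsLogGammaLike

theorem isLogGammaLike_log : IsLogGammaLike 0 fun z ↦ Complex.log (1 + z) where
  differentiableOn z hz := by
    refine ((differentiableAt_id.const_add 1).clog (Or.inl ?_)).differentiableWithinAt
    simp only [rightHalfPlane, Set.mem_ofPred_eq] at hz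
    simp
    linarith
  decay d _ := newtonDecay_log d
  fwdDiff_zero j hj := by
    obtain rfl : j = 0 := by omega
    simp
  tendsto_fwdDiff j hj := by
    induction j, hj using Nat.le_induction with
    | base =>
      -- The first difference is the degree-0 remainder at z = 1.
      obtain ⟨C, N₀, h⟩ := newtonDecay_log 0 1
      refine squeeze_zero_norm' (a := fun N : ℕ ↦ C / ((N : ℝ) + 1) ^ (0 + 1))
        (eventually_atTop.2 ⟨N₀, fun N hN ↦ ?_⟩) ?_
      · refine le_of_eq_of_le ?_ (h N hN 1 (by simp))
        simp [newtonRem, fwdDiff, add_comm (1 : ℂ) (N : ℂ)]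
      · refine Tendsto.div_atTop tendsto_const_nhds ?_
        exact (tendsto_pow_atTop (by omega)).comp
          (tendsto_atTop_add_const_right _ _ tendsto_natCast_atTop_atTop)
    | succ j hj ih =>
      rw [Function.iterate_succ_apply']
      have h := (ih.comp (tendsto_add_atTop_nat 1)).sub ih
      simpa only [Function.comp_def, Nat.cast_add, Nat.cast_one, sub_zero] using! h

/-! ### Logarithms of the multiple gamma functions -/

/-- `logGamma s z` is the logarithm of `G s (z + 1)` for `Re z > -1`. -/
noncomputable def logGamma : ℕ → ℂ → ℂ
  | 0 => fun z ↦ Complex.log (1 + z)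
  | s + 1 => diffPrimitive s (logGamma s)

theorem isLogGammaLike_logGamma (s : ℕ) : IsLogGammaLike s (logGamma s) := by
  induction s with
  | zero => exact isLogGammaLike_log
  | succ s ih => exact ih.diffPrimitive

theorem fwdDiff_logGamma (s : ℕ) : fwdDiff 1 (logGamma (s + 1)) = logGamma s :=
  (isLogGammaLike_logGamma s).fwdDiff_diffPrimitive

theorem fwdDiff_iterate_logGamma (s j : ℕ) :
    (fwdDiff 1)^[j] (logGamma (s + j)) = logGamma s := by
  induction j with
  | zero => rfl
  | succ j ih => rw [Function.iterate_succ_apply, ← add_assoc, fwdDiff_logGamma, ih]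

theorem logGamma_apply_zero (s : ℕ) : logGamma s 0 = 0 :=
  (isLogGammaLike_logGamma s).fwdDiff_zero 0 (Nat.zero_le s)

theorem logGamma_add_one (s : ℕ) (z : ℂ) :
    logGamma (s + 1) (z + 1) = logGamma s z + logGamma (s + 1) z := by
  rw [← fwdDiff_logGamma s, fwdDiff, sub_add_cancel]

/-! ### Reality and signs of derivatives -/

theorem TendstoLocallyUniformlyOn.iteratedDeriv {ι : Type*} {φ : Filter ι} {F : ι → ℂ → ℂ}
    {f : ℂ → ℂ} {U : Set ℂ} (hf : TendstoLocallyUniformlyOn F f φ U)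
    (hF : ∀ n, DifferentiableOn ℂ (F n) U) (hU : IsOpen U) (k : ℕ) :
    TendstoLocallyUniformlyOn (fun n ↦ _root_.iteratedDeriv k (F n))
      (_root_.iteratedDeriv k f) φ U := by
  induction k generalizing F f with
  | zero => simpa only [iteratedDeriv_zero] using hf
  | succ k ih =>
    simp only [iteratedDeriv_succ']
    exact ih (hf.deriv (Eventually.of_forall hF) hU) fun n ↦ (hF n).deriv hU

theorem DifferentiableOn.iteratedDeriv {f : ℂ → ℂ} {U : Set ℂ} (hf : DifferentiableOn ℂ f U)
    (hU : IsOpen U) (k : ℕ) : DifferentiableOn ℂ (_root_.iteratedDeriv k f) U := by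
  induction k with
  | zero => simpa only [iteratedDeriv_zero] using hf
  | succ k ih =>
    rw [iteratedDeriv_succ]
    exact ih.deriv hU

theorem iteratedDeriv_re_ofReal {f : ℂ → ℂ} {U : Set ℂ} (hf : DifferentiableOn ℂ f U)
    (hU : IsOpen U) (k : ℕ) {x : ℝ} (hx : (x : ℂ) ∈ U) :
    iteratedDeriv k (fun t : ℝ ↦ (f t).re) x = (iteratedDeriv k f x).re := by
  induction k generalizing x with
  | zero => simp only [iteratedDeriv_zero]
  | succ k ih =>
    have h : iteratedDeriv k (fun t : ℝ ↦ (f t).re) =ᶠ[𝓝 x] fun t ↦ (iteratedDeriv k f t).re := by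
      filter_upwards [(hU.preimage Complex.continuous_ofReal).mem_nhds hx] with t ht
      exact ih ht
    rw [iteratedDeriv_succ, iteratedDeriv_succ, h.deriv_eq]
    exact ((hf.iteratedDeriv hU k _ hx).differentiableAt
      (hU.mem_nhds hx)).hasDerivAt.real_of_complex.deriv

theorem Polynomial.iteratedDeriv_eval (p : Polynomial ℂ) (k : ℕ) (z : ℂ) :
    iteratedDeriv k (fun z ↦ p.eval z) z = (Polynomial.derivative^[k] p).eval z := by
  induction k generalizing p with
  | zero => simp
  | succ k ih =>
    rw [iteratedDeriv_succ', Function.iterate_succ_apply, ← ih]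
    congr 1
    funext z
    exact p.deriv

theorem ofReal_mem_rightHalfPlane {x : ℝ} : (x : ℂ) ∈ rightHalfPlane ↔ -1 < x := Iff.rfl

/-- `f` is real on the real half-line and its derivatives of order `j > s` alternate in sign. -/
structure IsRealAlternating (s : ℕ) (f : ℂ → ℂ) : Prop where
  im_eq_zero : ∀ x : ℝ, -1 < x → (f x).im = 0
  iteratedDeriv_nonneg : ∀ j > s, ∀ x : ℝ, -1 < x →
    0 ≤ (-1) ^ (j + s + 1) * (iteratedDeriv j f x).re

theorem im_fwdDiff_iterate_eq_zero {f : ℂ → ℂ} (hf : ∀ n : ℕ, (f n).im = 0) (j n : ℕ) :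
    ((fwdDiff 1)^[j] f (n : ℂ)).im = 0 := by
  induction j generalizing n with
  | zero => exact hf n
  | succ j ih =>
    have := ih (n + 1)
    push_cast at this
    rw [Function.iterate_succ_apply', fwdDiff, Complex.sub_im, this, ih n, sub_zero]

theorem ofReal_ringChoose (x : ℝ) (j : ℕ) : Ring.choose (x : ℂ) j = (Ring.choose x j : ℝ) :=
  (Ring.map_choose Complex.ofRealHom x j).symm

theorem IsRealAlternating.im_newtonRem {s : ℕ} {f : ℂ → ℂ} (hf : IsRealAlternating s f) (d M : ℕ)
    {x : ℝ} (hx : -1 < x) : (newtonRem f d M x).im = 0 := by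
  have hM : (0 : ℝ) ≤ M := M.cast_nonneg
  have h1 : (f (x + M)).im = 0 := by
    have := hf.im_eq_zero (x + M) (by linarith)
    push_cast at this
    exact this
  have h2 (n : ℕ) : (f n).im = 0 := by
    have hn : (0 : ℝ) ≤ n := n.cast_nonneg
    have := hf.im_eq_zero n (by linarith)
    push_cast at this
    exact this
  rw [newtonRem, Complex.sub_im, h1, Complex.im_sum, Finset.sum_eq_zero, sub_zero]
  intro j _
  rw [ofReal_ringChoose, Complex.im_ofReal_mul, im_fwdDiff_iterate_eq_zero h2, mul_zero]

theorem DifferentiableOn.contDiffAt_complex {f : ℂ → ℂ} {U : Set ℂ} (hf : DifferentiableOn ℂ f U)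
    (hU : IsOpen U) {z : ℂ} (hz : z ∈ U) {n : WithTop ℕ∞} : ContDiffAt ℂ n f z :=
  (hf.analyticAt (hU.mem_nhds hz)).contDiffAt

/-- The interpolation polynomial has degree at most d, so derivatives of order j > d kill it. -/
theorem iteratedDeriv_newtonRem {f : ℂ → ℂ} (hf : DifferentiableOn ℂ f rightHalfPlane) {d M j : ℕ}
    (hj : d < j) {z : ℂ} (hz : z ∈ rightHalfPlane) :
    iteratedDeriv j (newtonRem f d M) z = iteratedDeriv j f (z + M) := by
  choose c hcd hc using exists_polynomial_ringChoose
  let q : Polynomial ℂ :=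
    ∑ i ∈ Finset.range (d + 1), c i * Polynomial.C ((fwdDiff 1)^[i] f M)
  have hq : q.natDegree < j := by
    refine lt_of_le_of_lt ?_ hj
    refine Polynomial.natDegree_sum_le_of_forall_le _ _ fun i hi ↦ ?_
    refine (Polynomial.natDegree_mul_C_le _ _).trans ((hcd i).trans ?_)
    exact Nat.lt_succ_iff.1 (Finset.mem_range.1 hi)
  have h : newtonRem f d M = fun z ↦ f (z + M) - q.eval z := by
    funext z
    simp [newtonRem, q, hc, Polynomial.eval_finsetSum]
  have hzM := add_natCast_mem_rightHalfPlane hz M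
  rw [h, iteratedDeriv_fun_sub, Polynomial.iteratedDeriv_eval,
    Polynomial.iterate_derivative_eq_zero hq, Polynomial.eval_zero, sub_zero,
    iteratedDeriv_comp_add_const]
  · exact ContDiffAt.comp (g := f) z (hf.contDiffAt_complex isOpen_rightHalfPlane hzM)
      (contDiffAt_id.add contDiffAt_const)
  · exact (Polynomial.differentiable q).contDiff.contDiffAt

/-- For j > s + 1, termwise differentiation gives minus the sum of the j-th derivatives of f at x +
M: the sign flips once, matching s + 1 in place of s. -/
theorem IsRealAlternating.diffPrimitive {s : ℕ} {f : ℂ → ℂ} (hr : IsRealAlternating s f)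
    (hf : IsLogGammaLike s f) : IsRealAlternating (s + 1) (diffPrimitive s f) where
  im_eq_zero x hx := by
    have h := Complex.hasSum_im (hf.hasSum_newtonRem x)
    simp only [hr.im_newtonRem _ _ hx] at h
    simpa using h.unique hasSum_zero
  iteratedDeriv_nonneg j hj x hx := by
    have hx' : (x : ℂ) ∈ rightHalfPlane := hx
    have hd (M : ℕ) : DifferentiableOn ℂ (newtonRem f (s + 1) M) rightHalfPlane := fun z hz ↦
      (hf.differentiableAt_newtonRem _ M hz).differentiableWithinAt
    have h1 : TendstoLocallyUniformlyOn (fun N z ↦ ∑ M ∈ Finset.range N, newtonRem f (s + 1) M z)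
        (fun z ↦ -_root_.diffPrimitive s f z) atTop rightHalfPlane := by
      refine hf.summableLocallyUniformlyOn.hasSumLocallyUniformlyOn
        |>.tendstoLocallyUniformlyOn_finsetRange.congr_right fun z _ ↦ ?_
      exact (hf.hasSum_newtonRem z).tsum_eq
    have h2 := ((h1.iteratedDeriv (fun N ↦ DifferentiableOn.fun_sum fun M _ ↦ hd M)
      isOpen_rightHalfPlane j).tendsto_at hx')
    have h3 (N : ℕ) : iteratedDeriv j (fun z ↦ ∑ M ∈ Finset.range N, newtonRem f (s + 1) M z) x =
        ∑ M ∈ Finset.range N, iteratedDeriv j f (x + M) := by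
      induction N with
      | zero => simp
      | succ N ih =>
        simp only [Finset.sum_range_succ]
        rw [iteratedDeriv_fun_add, ih, iteratedDeriv_newtonRem hf.differentiableOn hj hx']
        · exact (DifferentiableOn.fun_sum fun M _ ↦ hd M).contDiffAt_complex
            isOpen_rightHalfPlane hx'
        · exact (hd N).contDiffAt_complex isOpen_rightHalfPlane hx'
    simp only [h3, iteratedDeriv_fun_neg] at h2
    have h4 := ((Complex.continuous_re.tendsto _).comp h2).const_mul ((-1 : ℝ) ^ (j + s + 1))
    have h5 := ge_of_tendsto' h4 (b := 0) fun N ↦ ?_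
    · rw [Complex.neg_re] at h5
      rw [show j + (s + 1) + 1 = j + s + 1 + 1 by ring, pow_succ]
      linarith
    · rw [Function.comp_apply, Complex.re_sum, Finset.mul_sum]
      refine Finset.sum_nonneg fun M _ ↦ ?_
      have hM : (0 : ℝ) ≤ M := M.cast_nonneg
      have := hr.iteratedDeriv_nonneg j (by omega) (x + M) (by linarith)
      push_cast at this
      exact this

theorem isRealAlternating_log : IsRealAlternating 0 fun z ↦ Complex.log (1 + z) where
  im_eq_zero x hx := by
    have : (1 + x : ℂ) = ((1 + x : ℝ) : ℂ) := by push_cast; rfl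
    rw [this, ← Complex.ofReal_log (by linarith), Complex.ofReal_im]
  iteratedDeriv_nonneg j hj x hx := by
    obtain ⟨k, rfl⟩ : ∃ k, j = k + 1 := ⟨j - 1, by omega⟩
    have h : deriv (fun z ↦ Complex.log (1 + z)) =ᶠ[𝓝 (x : ℂ)] fun z ↦ (1 + z)⁻¹ := by
      filter_upwards [isOpen_rightHalfPlane.mem_nhds (show (x : ℂ) ∈ rightHalfPlane from hx)]
        with z hz
      have hs : 1 + z ∈ Complex.slitPlane := Or.inl <| by
        have : -1 < z.re := hz
        simp
        linarith
      simpa using (((hasDerivAt_id z).const_add 1).clog hs).deriv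
    rw [iteratedDeriv_succ', h.iteratedDeriv_eq,
      iteratedDeriv_comp_const_add k (fun z : ℂ ↦ z⁻¹) 1, iteratedDeriv_eq_iterate]
    have h2 := iter_deriv_inv k (1 + (x : ℂ))
    simp only [Inv.inv] at h2 ⊢
    erw [h2]
    have h3 : ((-1) ^ k * k.factorial * (1 + (x : ℂ)) ^ (-1 - k : ℤ)) =
        (((-1) ^ k * k.factorial * (1 + x) ^ (-1 - k : ℤ) : ℝ) : ℂ) := by push_cast; rfl
    rw [h3, Complex.ofReal_re]
    have h4 : (0 : ℝ) ≤ k.factorial * (1 + x) ^ (-1 - k : ℤ) := by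
      have : 0 < 1 + x := by linarith
      positivity
    have h5 : (-1 : ℝ) ^ (k + 1 + 0 + 1) * (-1) ^ k = 1 := by
      rw [← pow_add, show k + 1 + 0 + 1 + k = 2 * (k + 1) by ring, pow_mul]
      simp
    calc _ ≤ (k.factorial * (1 + x) ^ (-1 - k : ℤ) : ℝ) := h4
      _ = _ := by rw [mul_assoc, ← mul_assoc, h5, one_mul]

theorem isRealAlternating_logGamma (s : ℕ) : IsRealAlternating s (logGamma s) := by
  induction s with
  | zero => exact isRealAlternating_log
  | succ s ih => exact ih.diffPrimitive (isLogGammaLike_logGamma s)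

theorem iteratedDeriv_logGamma_nonneg (s : ℕ) {x : ℝ} (hx : -1 < x) :
    0 ≤ iteratedDeriv (s + 1) (fun t : ℝ ↦ (logGamma s t).re) x := by
  rw [iteratedDeriv_re_ofReal (isLogGammaLike_logGamma s).differentiableOn isOpen_rightHalfPlane
    _ (ofReal_mem_rightHalfPlane.2 hx)]
  have h := (isRealAlternating_logGamma s).iteratedDeriv_nonneg (s + 1) (by omega) x hx
  rwa [show s + 1 + s + 1 = 2 * (s + 1) by ring, pow_mul, neg_one_sq, one_pow, one_mul] at h

/-! ### Uniqueness on the real half-line -/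

section RealUniqueness

theorem AnalyticAt.iteratedDeriv_real {f : ℝ → ℝ} {x : ℝ} (hf : AnalyticAt ℝ f x) (k : ℕ) :
    AnalyticAt ℝ (iteratedDeriv k f) x := by
  rw [iteratedDeriv_eq_iterate]
  exact hf.iterated_deriv k

theorem AnalyticAt.comp_add_const_real {f : ℝ → ℝ} {x c : ℝ} (hf : AnalyticAt ℝ f (x + c)) :
    AnalyticAt ℝ (fun t ↦ f (t + c)) x :=
  AnalyticAt.fun_comp (g := f) hf (analyticAt_id.add analyticAt_const)

theorem exists_hasDerivAt_eq_sub {f : ℝ → ℝ} {x : ℝ} (hf : ∀ y ≥ x, AnalyticAt ℝ f y) :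
    ∃ y ∈ Set.Ioo x (x + 1), f (x + 1) - f x = deriv f y := by
  obtain ⟨y, hy, h⟩ := exists_deriv_eq_slope f (lt_add_one x)
    (fun y hy ↦ (hf y hy.1).continuousAt.continuousWithinAt)
    (fun y hy ↦ (hf y hy.1.le).differentiableAt.differentiableWithinAt)
  refine ⟨y, hy, ?_⟩
  rw [h, add_sub_cancel_left, div_one]

/-- The mean value theorem iterated: induction applies to the first difference, whose k-th
derivative is again a difference. -/
theorem exists_iteratedDeriv_eq_fwdDiff_iterate {f : ℝ → ℝ} (k : ℕ) {x : ℝ}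
    (hf : ∀ y ≥ x, AnalyticAt ℝ f y) :
    ∃ y ∈ Set.Icc x (x + k), (fwdDiff 1)^[k] f x = iteratedDeriv k f y := by
  induction k generalizing f with
  | zero => exact ⟨x, by simp, by simp⟩
  | succ k ih =>
    have hf1 : ∀ y ≥ x, AnalyticAt ℝ (fun t ↦ f (t + 1)) y := fun y hy ↦
      (hf (y + 1) (by linarith)).comp_add_const_real
    obtain ⟨y, hy, h⟩ := ih (f := fwdDiff 1 f) fun y hy ↦ (hf1 y hy).sub (hf y hy)
    obtain ⟨w, hw, h'⟩ := exists_hasDerivAt_eq_sub (f := iteratedDeriv k f) (x := y)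
      fun w hw ↦ (hf w (hy.1.trans hw)).iteratedDeriv_real k
    refine ⟨w, ⟨hy.1.trans hw.1.le, ?_⟩, ?_⟩
    · have := hy.2
      have := hw.2
      push_cast
      linarith
    · rw [Function.iterate_succ_apply, h, iteratedDeriv_succ, ← h']
      have e : fwdDiff 1 f = fun t ↦ f (t + 1) - f t := rfl
      rw [e, iteratedDeriv_fun_sub (hf1 y hy.1).contDiffAt (hf y hy.1).contDiffAt,
        iteratedDeriv_comp_add_const]

/-- The derivative is periodic too, hence constant by induction; the mean value theorem over one
period makes that constant zero. -/
theorem exists_eq_const_of_periodic_of_iteratedDeriv_eq_zero {f : ℝ → ℝ}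
    (hf : ∀ x > 0, AnalyticAt ℝ f x) (hp : ∀ x > 0, f (x + 1) = f x) {k : ℕ}
    (hk : ∀ x > 0, iteratedDeriv k f x = 0) : ∃ c, ∀ x > 0, f x = c := by
  induction k generalizing f with
  | zero => exact ⟨0, by simpa only [iteratedDeriv_zero] using hk⟩
  | succ k ih =>
    obtain ⟨c, hc⟩ := ih (f := deriv f) (fun x hx ↦ (hf x hx).deriv) (fun x hx ↦ by
        rw [← deriv_comp_add_const]
        refine EventuallyEq.deriv_eq ?_
        filter_upwards [lt_mem_nhds hx] with y hy using hp y hy)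
      (by simpa only [iteratedDeriv_succ'] using hk)
    obtain ⟨y, hy, h⟩ := exists_hasDerivAt_eq_sub (f := f) (x := 1)
      fun y hy ↦ hf y (by linarith)
    rw [hp 1 one_pos, sub_self, hc y (by linarith [hy.1])] at h
    refine ⟨f 1, fun x hx ↦ ?_⟩
    exact isOpen_Ioi.is_const_of_deriv_eq_zero (convex_Ioi (0 : ℝ)).isPreconnected
      (fun y hy ↦ (hf y hy).differentiableAt.differentiableWithinAt)
      (fun y hy ↦ by rw [hc y hy, ← h, Pi.zero_apply]) hx (Set.mem_Ioi.2 one_pos)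

/-- L(x) is a value of the increasing k-th derivative on [x, x + k], for g and for h alike. So both
k-th derivatives at x + n + k lie between L(x + n) and L(x + n + k), and their difference does not
depend on n. -/
theorem exists_sub_eq_const_of_fwdDiff_iterate_eq {g h L : ℝ → ℝ} {k : ℕ}
    (hg : ∀ x > 0, AnalyticAt ℝ g x) (hh : ∀ x > 0, AnalyticAt ℝ h x)
    (hgL : ∀ x > 0, (fwdDiff 1)^[k] g x = L x) (hhL : ∀ x > 0, (fwdDiff 1)^[k] h x = L x)
    (hg' : ∀ x > 0, 0 ≤ iteratedDeriv (k + 1) g x) (hh' : ∀ x > 0, 0 ≤ iteratedDeriv (k + 1) h x)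
    (hL : ∀ x > 0, Tendsto (fun n : ℕ ↦ L (x + n + k) - L (x + n)) atTop (𝓝 0))
    (hp : ∀ x > 0, g (x + 1) - h (x + 1) = g x - h x) : ∃ c, ∀ x > 0, g x - h x = c := by
  have hmono (f : ℝ → ℝ) (hf : ∀ x > 0, AnalyticAt ℝ f x)
      (hf' : ∀ x > 0, 0 ≤ iteratedDeriv (k + 1) f x) :
      MonotoneOn (iteratedDeriv k f) (Set.Ioi 0) := by
    refine monotoneOn_of_deriv_nonneg (convex_Ioi 0)
      (fun x hx ↦ ((hf x hx).iteratedDeriv_real k).continuousAt.continuousWithinAt) ?_ ?_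
    · rw [interior_Ioi]
      exact fun x hx ↦ ((hf x hx).iteratedDeriv_real k).differentiableAt.differentiableWithinAt
    · rw [interior_Ioi]
      intro x hx
      rw [← iteratedDeriv_succ]
      exact hf' x hx
  have hbound (f : ℝ → ℝ) (hf : ∀ x > 0, AnalyticAt ℝ f x)
      (hf' : ∀ x > 0, 0 ≤ iteratedDeriv (k + 1) f x) (hfL : ∀ x > 0, (fwdDiff 1)^[k] f x = L x)
      (x : ℝ) (hx : 0 < x) : iteratedDeriv k f x ≤ L x ∧ L x ≤ iteratedDeriv k f (x + k) := by
    have hk0 : (0 : ℝ) ≤ k := k.cast_nonneg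
    obtain ⟨y, hy, h⟩ := exists_iteratedDeriv_eq_fwdDiff_iterate (f := f) k (x := x)
      fun y hy ↦ hf y (by linarith)
    rw [hfL x hx] at h
    have hy0 : 0 < y := by linarith [hy.1]
    rw [h]
    exact ⟨hmono f hf hf' hx hy0 hy.1, hmono f hf hf' hy0 (by simp; linarith) hy.2⟩
  have hpa : ∀ x > 0, AnalyticAt ℝ (fun x ↦ g x - h x) x := fun x hx ↦ (hg x hx).sub (hh x hx)
  have hper (n : ℕ) : ∀ x > 0, iteratedDeriv k (fun x ↦ g x - h x) (x + n) =
      iteratedDeriv k (fun x ↦ g x - h x) x := by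
    induction n with
    | zero => simp
    | succ n ih =>
      intro x hx
      have hn : (0 : ℝ) ≤ n := n.cast_nonneg
      rw [← ih x hx, Nat.cast_succ, ← add_assoc]
      rw [← congrFun (iteratedDeriv_comp_add_const k (fun x ↦ g x - h x) 1) (x + n)]
      refine EventuallyEq.iteratedDeriv_eq k ?_
      filter_upwards [lt_mem_nhds (show 0 < x + n by linarith)] with y hy using hp y hy
  refine exists_eq_const_of_periodic_of_iteratedDeriv_eq_zero (k := k) hpa hp fun x hx ↦ ?_
  have hle (n : ℕ) : |iteratedDeriv k (fun x ↦ g x - h x) x| ≤ L (x + n + k) - L (x + n) := by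
    have hn : (0 : ℝ) ≤ n := n.cast_nonneg
    have hk0 : (0 : ℝ) ≤ k := k.cast_nonneg
    have hx1 : 0 < x + n := by linarith
    have hx2 : 0 < x + n + k := by linarith
    have e := hper (n + k) x hx
    rw [Nat.cast_add, ← add_assoc, iteratedDeriv_fun_sub (hg _ hx2).contDiffAt
      (hh _ hx2).contDiffAt] at e
    have h1 := hbound g hg hg' hgL _ hx1
    have h2 := hbound g hg hg' hgL _ hx2
    have h3 := hbound h hh hh' hhL _ hx1
    have h4 := hbound h hh hh' hhL _ hx2
    rw [← e, abs_le]
    constructor <;> linarith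
  have := ge_of_tendsto' (hL x hx) hle
  exact abs_eq_zero.1 (le_antisymm this (abs_nonneg _))

end RealUniqueness

/-! ### Uniqueness of the meromorphic sequence -/

/-- Zeros of f - g accumulate at a + 1, and infinite order spreads over the connected plane. Normal
form upgrades agreement near each point to agreement at it. -/
theorem MeromorphicNFOn.eq_of_eqOn_Ioi {f g : ℂ → ℂ} (hf : MeromorphicNFOn f Set.univ)
    (hg : MeromorphicNFOn g Set.univ) {a : ℝ} (h : ∀ x : ℝ, a < x → f x = g x) : f = g := by
  have hm : MeromorphicOn (f - g) Set.univ := hf.meromorphicOn.sub hg.meromorphicOn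
  have htop (z : ℂ) : meromorphicOrderAt (f - g) z = ⊤ := by
    by_contra hz
    have h1 := hm.meromorphicOrderAt_ne_top_of_isPreconnected (y := ((a + 1 : ℝ) : ℂ))
      isPreconnected_univ (Set.mem_univ z) (Set.mem_univ _) hz
    rw [meromorphicOrderAt_ne_top_iff_eventually_ne_zero (hm _ (Set.mem_univ _))] at h1
    have h2 : Tendsto ((↑) : ℝ → ℂ) (𝓝[≠] (a + 1)) (𝓝[≠] ((a + 1 : ℝ) : ℂ)) :=
      tendsto_nhdsWithin_of_tendsto_nhds_of_eventually_within _
        (Complex.continuous_ofReal.tendsto _ |>.mono_left nhdsWithin_le_nhds)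
        (eventually_mem_nhdsWithin.mono fun x hx h ↦ hx (Complex.ofReal_injective h))
    obtain ⟨x, hx1, hx2⟩ := ((h2.eventually h1).and
      (nhdsWithin_le_nhds (lt_mem_nhds (lt_add_one a)))).exists
    exact hx1 (by rw [Pi.sub_apply, h x hx2, sub_self])
  funext z
  have h1 := meromorphicOrderAt_eq_top_iff.1 (htop z)
  refine (((hf (Set.mem_univ z)).eventuallyEq_nhdsNE_iff_eventuallyEq_nhds
    (hg (Set.mem_univ z))).1 ?_).eq_of_nhds
  filter_upwards [h1] with w hw using sub_eq_zero.1 hw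

theorem MeromorphicNFAt.analyticAt_of_ne_zero {f : ℂ → ℂ} {z : ℂ} (hf : MeromorphicNFAt f z)
    (h : f z ≠ 0) : AnalyticAt ℂ f z :=
  hf.meromorphicOrderAt_nonneg_iff_analyticAt.1 (hf.meromorphicOrderAt_eq_zero_iff.2 h).ge

theorem Filter.EventuallyEq.eq_of_codiscrete {f g : ℂ → ℂ} (h : f =ᶠ[codiscrete ℂ] g) {z : ℂ}
    (hf : ContinuousAt f z) (hg : ContinuousAt g z) : f z = g z := by
  have h' : f =ᶠ[𝓝[≠] z] g := by
    have := mem_codiscrete.1 h z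
    rw [disjoint_principal_right, compl_compl] at this
    exact this
  exact ((hf.eventuallyEq_nhds_iff_eventuallyEq_nhdsNE hg).1 h').eq_of_nhds

namespace IsMultipleGammaSeq

variable {G : ℕ → ℂ → ℂ}

theorem ne_zero (hG : IsMultipleGammaSeq G) (r : ℕ) {x : ℝ} (hx : 0 ≤ x) : G r (x + 1) ≠ 0 :=
  fun h ↦ by simpa [h] using (hG.pos r x hx).1

theorem analyticAt (hG : IsMultipleGammaSeq G) (r : ℕ) {x : ℝ} (hx : 0 ≤ x) :
    AnalyticAt ℂ (G r) (x + 1) :=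
  (hG.meromorphic r (Set.mem_univ _)).analyticAt_of_ne_zero (hG.ne_zero r hx)

theorem apply_add_one (hG : IsMultipleGammaSeq G) (r : ℕ) {x : ℝ} (hx : 0 ≤ x) :
    G (r + 1) (x + 1 + 1) = G r (x + 1) * G (r + 1) (x + 1) := by
  refine (hG.functional_eq r).eq_of_codiscrete (z := (x : ℂ) + 1) ?_ ?_
  · have h := (hG.analyticAt (r + 1) (x := x + 1) (by linarith)).continuousAt
    push_cast at h
    exact ContinuousAt.comp (g := G (r + 1)) h (continuousAt_id.add continuousAt_const)
  · exact (hG.analyticAt r hx).continuousAt.mul (hG.analyticAt (r + 1) hx).continuousAt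

theorem apply_eq_ofReal (hG : IsMultipleGammaSeq G) (r : ℕ) {x : ℝ} (hx : 0 ≤ x) :
    G r (x + 1) = ((G r (x + 1)).re : ℂ) :=
  Complex.ext rfl (by rw [(hG.pos r x hx).2, Complex.ofReal_im])

theorem log_re_add_one (hG : IsMultipleGammaSeq G) (r : ℕ) {x : ℝ} (hx : 0 ≤ x) :
    Real.log (G (r + 1) ((x + 1 : ℝ) + 1)).re =
      Real.log (G r (x + 1)).re + Real.log (G (r + 1) (x + 1)).re := by
  push_cast
  rw [hG.apply_add_one r hx, hG.apply_eq_ofReal r hx, hG.apply_eq_ofReal (r + 1) hx,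
    Complex.re_ofReal_mul, Complex.ofReal_re, Complex.ofReal_re,
    Real.log_mul (hG.pos r x hx).1.ne' (hG.pos (r + 1) x hx).1.ne']

theorem analyticAt_log_re (hG : IsMultipleGammaSeq G) (r : ℕ) {x : ℝ} (hx : 0 ≤ x) :
    AnalyticAt ℝ (fun t : ℝ ↦ Real.log (G r (t + 1)).re) x := by
  refine AnalyticAt.log ?_ (hG.pos r x hx).1
  refine AnalyticAt.re_ofReal (f := fun z ↦ G r (z + 1)) ?_
  exact AnalyticAt.fun_comp (g := G r) (hG.analyticAt r hx) (analyticAt_id.add analyticAt_const)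

theorem fwdDiff_iterate_log_re (hG : IsMultipleGammaSeq G) (r k : ℕ) {x : ℝ} (hx : 0 ≤ x) :
    (fwdDiff 1)^[k] (fun t : ℝ ↦ Real.log (G (r + k) (t + 1)).re) x =
      Real.log (G r (x + 1)).re := by
  induction k generalizing r x with
  | zero => rfl
  | succ k ih =>
    rw [Function.iterate_succ_apply', fwdDiff]
    have e : r + (k + 1) = r + 1 + k := by ring
    rw [e, ih (r + 1) hx, ih (r + 1) (by linarith : 0 ≤ x + 1), hG.log_re_add_one r hx]
    ring

theorem tendsto_log_add_sub_log {x : ℝ} (hx : 0 < x) (k : ℕ) :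
    Tendsto (fun n : ℕ ↦ Real.log (x + n + k + 1) - Real.log (x + n + 1)) atTop (𝓝 0) := by
  have h1 : Tendsto (fun n : ℕ ↦ 1 + (k : ℝ) / (x + n + 1)) atTop (𝓝 (1 + 0)) := by
    refine (Tendsto.div_atTop tendsto_const_nhds ?_).const_add 1
    exact tendsto_atTop_add_const_right _ _
      (tendsto_atTop_add_const_left _ _ tendsto_natCast_atTop_atTop)
  rw [add_zero] at h1
  have h2 := (Real.continuousAt_log one_ne_zero).tendsto.comp h1
  rw [Real.log_one] at h2
  refine h2.congr fun n ↦ ?_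
  have hn : (0 : ℝ) ≤ n := n.cast_nonneg
  have hk : (0 : ℝ) ≤ k := k.cast_nonneg
  have h3 : 0 < x + n + 1 := by linarith
  rw [Function.comp_apply, ← Real.log_div (by linarith) h3.ne']
  congr 1
  field_simp
  ring

theorem unique {G' : ℕ → ℂ → ℂ} (hG : IsMultipleGammaSeq G) (hG' : IsMultipleGammaSeq G') :
    G = G' := by
  funext r
  induction r with
  | zero => exact funext fun z ↦ by rw [hG.zero, hG'.zero]
  | succ r ih =>
    have hL {H : ℕ → ℂ → ℂ} (hH : IsMultipleGammaSeq H) (x : ℝ) (hx : 0 < x) :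
        (fwdDiff 1)^[r + 1] (fun t : ℝ ↦ Real.log (H (r + 1) (t + 1)).re) x =
          Real.log (x + 1) := by
      have h := hH.fwdDiff_iterate_log_re 0 (r + 1) hx.le
      rw [zero_add, hH.zero] at h
      simpa using h
    obtain ⟨c, hc⟩ := exists_sub_eq_const_of_fwdDiff_iterate_eq (L := fun x ↦ Real.log (x + 1))
      (k := r + 1) (fun x hx ↦ hG.analyticAt_log_re (r + 1) hx.le)
      (fun x hx ↦ hG'.analyticAt_log_re (r + 1) hx.le) (hL hG) (hL hG')
      (fun x hx ↦ hG.iteratedDeriv_log_nonneg (r + 1) x hx.le)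
      (fun x hx ↦ hG'.iteratedDeriv_log_nonneg (r + 1) x hx.le)
      (fun x hx ↦ tendsto_log_add_sub_log hx (r + 1))
      (fun x hx ↦ by rw [hG.log_re_add_one r hx.le, hG'.log_re_add_one r hx.le, ih]; ring)
    -- The constant is known only as a value at x > 0, so the normalisation at 1 is carried to G(2)
    -- = 1 by the functional equation.
    have h1 {H : ℕ → ℂ → ℂ} (hH : IsMultipleGammaSeq H) :
        Real.log (H (r + 1) ((1 : ℝ) + 1)).re = 0 := by
      have h := hH.log_re_add_one r le_rfl
      rw [zero_add, Complex.ofReal_zero, zero_add, hH.one, hH.one] at h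
      simpa using h
    have hc1 := hc 1 one_pos
    rw [h1 hG, h1 hG', sub_self] at hc1
    refine (hG.meromorphic (r + 1)).eq_of_eqOn_Ioi (hG'.meromorphic (r + 1)) (a := 1) fun x hx ↦ ?_
    have h2 := hc (x - 1) (by linarith)
    rw [← hc1, sub_eq_zero] at h2
    have hx0 : 0 ≤ x - 1 := by linarith
    have h3 := Real.log_injOn_pos (hG.pos (r + 1) _ hx0).1 (hG'.pos (r + 1) _ hx0).1 h2
    have e : (x : ℂ) = ((x - 1 : ℝ) : ℂ) + 1 := by push_cast; ring
    rw [e, hG.apply_eq_ofReal _ hx0, hG'.apply_eq_ofReal _ hx0, h3]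

end IsMultipleGammaSeq

/-! ### Existence by meromorphic continuation -/

/-- The complex plane without the non-positive integers. -/
def offNonposInt : Set ℂ := {z | ∀ m : ℕ, z ≠ -(m : ℂ)}

theorem isOpen_offNonposInt : IsOpen offNonposInt := by
  -- The excluded points are the zeros of the entire function 1/Γ, hence form a closed set.
  have h : offNonposInt = {z | (Complex.Gamma z)⁻¹ ≠ 0} := by
    ext z
    refine ⟨fun hz ↦ inv_ne_zero (Complex.Gamma_ne_zero hz), fun hz m hm ↦ hz ?_⟩
    rw [hm, Complex.Gamma_neg_nat_eq_zero, inv_zero]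
  rw [h]
  exact isOpen_ne_fun Complex.differentiable_one_div_Gamma.continuous continuous_const

theorem eventually_mem_offNonposInt (z : ℂ) : ∀ᶠ w in 𝓝[≠] z, w ∈ offNonposInt := by
  by_cases hz : z ∈ offNonposInt
  · exact nhdsWithin_le_nhds (isOpen_offNonposInt.mem_nhds hz)
  · obtain ⟨m, hm⟩ : ∃ m : ℕ, z = -(m : ℂ) := by simpa [offNonposInt] using hz
    filter_upwards [nhdsWithin_le_nhds (Metric.ball_mem_nhds z one_pos), self_mem_nhdsWithin]
      with w hw hwz n hn
    rw [Metric.mem_ball, dist_eq_norm, hn, hm] at hw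
    have h1 : ‖(((m : ℤ) - n : ℤ) : ℂ)‖ < 1 := by
      push_cast
      rwa [neg_sub_neg] at hw
    rw [Complex.norm_intCast] at h1
    have h2 : |(m : ℤ) - n| < 1 := by exact_mod_cast h1
    rw [Int.abs_lt_one_iff, sub_eq_zero] at h2
    have h3 : m = n := by exact_mod_cast h2
    exact hwz (by rw [Set.mem_singleton_iff, hn, hm, h3])

theorem offNonposInt_mem_codiscrete : offNonposInt ∈ codiscrete ℂ := by
  refine mem_codiscrete.2 fun z ↦ ?_
  rw [disjoint_principal_right, compl_compl]
  exact eventually_mem_offNonposInt z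

theorem add_natCast_mem_offNonposInt {z : ℂ} (hz : z ∈ offNonposInt) (n : ℕ) :
    z + n ∈ offNonposInt := fun m hm ↦ hz (m + n) (by push_cast; linear_combination hm)

theorem mem_offNonposInt_of_re_pos {z : ℂ} (hz : 0 < z.re) : z ∈ offNonposInt := by
  rintro m rfl
  have : (0 : ℝ) ≤ m := m.cast_nonneg
  simp at hz
  linarith

theorem add_one_mem_offNonposInt_iff {z : ℂ} : z + 1 ∈ offNonposInt ↔ z ∈ offNegInt := by
  constructor
  · intro h m hm hz
    refine h (m - 1) ?_
    rw [hz, Nat.cast_sub hm]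
    push_cast
    ring
  · intro h m hz
    refine h (m + 1) (by omega) ?_
    push_cast
    linear_combination hz

theorem isOpen_offNegInt : IsOpen offNegInt := by
  have : offNegInt = (fun z ↦ z + 1) ⁻¹' offNonposInt :=
    Set.ext fun z ↦ add_one_mem_offNonposInt_iff.symm
  rw [this]
  exact isOpen_offNonposInt.preimage (continuous_id.add continuous_const)

theorem exists_nat_re_add_pos (z : ℂ) : ∃ m : ℕ, 0 < (z + m).re := by
  obtain ⟨m, hm⟩ := exists_nat_gt (-z.re)
  exact ⟨m, by simp; linarith⟩

section Extension

/-- The value at `z` obtained by solving `F (z + m) = F z * ∏ i < m, H (z + i)`. -/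
noncomputable def shiftQuotient (F H : ℂ → ℂ) (m : ℕ) (z : ℂ) : ℂ :=
  F (z + m) / ∏ i ∈ Finset.range m, H (z + i)

/-- The extension of `F`, given on `Re z > 0` and satisfying `F (z + 1) = H z * F z` there. -/
noncomputable def shiftExtension (F H : ℂ → ℂ) (z : ℂ) : ℂ :=
  shiftQuotient F H (exists_nat_re_add_pos z).choose z

variable {F H : ℂ → ℂ}

theorem prod_ne_zero_of_mem_offNonposInt (hH : ∀ z ∈ offNonposInt, H z ≠ 0) {z : ℂ}
    (hz : z ∈ offNonposInt) (m : ℕ) : ∏ i ∈ Finset.range m, H (z + i) ≠ 0 :=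
  Finset.prod_ne_zero_iff.2 fun i _ ↦ hH _ (add_natCast_mem_offNonposInt hz i)

/-- Extra shifts cancel by the functional equation, so the arbitrary choice of m in the extension is
harmless and m can be fixed locally. -/
theorem shiftQuotient_eq_of_le (hH : ∀ z ∈ offNonposInt, H z ≠ 0)
    (hF : ∀ z, 0 < z.re → F (z + 1) = H z * F z) {z : ℂ} (hz : z ∈ offNonposInt) {m n : ℕ}
    (hm : 0 < (z + m).re) (hmn : m ≤ n) : shiftQuotient F H n z = shiftQuotient F H m z := by
  induction n, hmn using Nat.le_induction with
  | base => rfl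
  | succ n hmn ih =>
    have hn : 0 < (z + n).re := by
      have : (m : ℝ) ≤ n := by exact_mod_cast hmn
      simp at hm ⊢
      linarith
    have h1 := hH _ (add_natCast_mem_offNonposInt hz n)
    rw [← ih, shiftQuotient, shiftQuotient, Finset.prod_range_succ, Nat.cast_succ, ← add_assoc,
      hF _ hn, mul_comm (∏ i ∈ Finset.range n, H (z + i)), mul_div_mul_left _ _ h1]

theorem shiftExtension_eq (hH : ∀ z ∈ offNonposInt, H z ≠ 0)
    (hF : ∀ z, 0 < z.re → F (z + 1) = H z * F z) {z : ℂ} (hz : z ∈ offNonposInt) {m : ℕ}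
    (hm : 0 < (z + m).re) : shiftExtension F H z = shiftQuotient F H m z := by
  rw [shiftExtension, ← shiftQuotient_eq_of_le hH hF hz hm (le_max_left m _),
    ← shiftQuotient_eq_of_le hH hF hz (exists_nat_re_add_pos z).choose_spec (le_max_right m _)]

theorem eventually_re_add_natCast_pos {z : ℂ} {m : ℕ} (hm : 0 < (z + m).re) :
    ∀ᶠ w : ℂ in 𝓝 z, 0 < (w + m).re :=
  (isOpen_lt continuous_const
    (Complex.continuous_re.comp (continuous_id.add continuous_const))).mem_nhds hm

theorem meromorphicAt_shiftExtension (hH : ∀ z ∈ offNonposInt, H z ≠ 0)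
    (hF : ∀ z, 0 < z.re → F (z + 1) = H z * F z) (hHm : MeromorphicOn H Set.univ)
    (hFa : ∀ z : ℂ, 0 < z.re → AnalyticAt ℂ F z) (z : ℂ) :
    MeromorphicAt (shiftExtension F H) z := by
  obtain ⟨m, hm⟩ := exists_nat_re_add_pos z
  have h : MeromorphicAt (shiftQuotient F H m) z := by
    refine MeromorphicAt.div (AnalyticAt.meromorphicAt ?_) ?_
    · exact AnalyticAt.fun_comp (g := F) (hFa _ hm) (analyticAt_id.add analyticAt_const)
    · exact MeromorphicAt.fun_prod fun i _ ↦
        meromorphicAt_comp_add_const_iff_meromorphicAt.2 (hHm _ (Set.mem_univ _))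
  refine h.congr ?_
  filter_upwards [eventually_mem_offNonposInt z,
    nhdsWithin_le_nhds (eventually_re_add_natCast_pos hm)] with w hw1 hw2
  exact (shiftExtension_eq hH hF hw1 hw2).symm

theorem analyticAt_shiftExtension (hH : ∀ z ∈ offNonposInt, H z ≠ 0)
    (hF : ∀ z, 0 < z.re → F (z + 1) = H z * F z) (hHa : ∀ z ∈ offNonposInt, AnalyticAt ℂ H z)
    (hFa : ∀ z : ℂ, 0 < z.re → AnalyticAt ℂ F z) {z : ℂ} (hz : z ∈ offNonposInt) :
    AnalyticAt ℂ (shiftExtension F H) z := by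
  obtain ⟨m, hm⟩ := exists_nat_re_add_pos z
  have h : AnalyticAt ℂ (shiftQuotient F H m) z := by
    refine AnalyticAt.div ?_ ?_ (prod_ne_zero_of_mem_offNonposInt hH hz m)
    · exact AnalyticAt.fun_comp (g := F) (hFa _ hm) (analyticAt_id.add analyticAt_const)
    · exact Finset.analyticAt_fun_prod _ fun i _ ↦ AnalyticAt.fun_comp (g := H)
        (hHa _ (add_natCast_mem_offNonposInt hz i)) (analyticAt_id.add analyticAt_const)
  refine h.congr ?_
  filter_upwards [isOpen_offNonposInt.mem_nhds hz, eventually_re_add_natCast_pos hm]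
    with w hw1 hw2
  exact (shiftExtension_eq hH hF hw1 hw2).symm

theorem shiftExtension_add_one (hH : ∀ z ∈ offNonposInt, H z ≠ 0)
    (hF : ∀ z, 0 < z.re → F (z + 1) = H z * F z) {z : ℂ} (hz : z ∈ offNonposInt) :
    shiftExtension F H (z + 1) = H z * shiftExtension F H z := by
  obtain ⟨m, hm⟩ := exists_nat_re_add_pos z
  have hz1 : z + 1 ∈ offNonposInt := by simpa using add_natCast_mem_offNonposInt hz 1
  have h0 : H z ≠ 0 := hH z hz
  rw [shiftExtension_eq hH hF hz1 (m := m) (by simp at hm ⊢; linarith),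
    shiftExtension_eq hH hF hz (m := m + 1) (by simp at hm ⊢; linarith), shiftQuotient,
    shiftQuotient, Finset.prod_range_succ']
  have e (i : ℕ) : z + ((i + 1 : ℕ) : ℂ) = z + 1 + i := by push_cast; ring
  simp only [e, Nat.cast_zero, add_zero]
  rw [mul_comm _ (H z), ← mul_div_assoc, mul_div_mul_left _ _ h0]

end Extension

/-- The multiple gamma functions. -/
noncomputable def multipleGamma : ℕ → ℂ → ℂ
  | 0 => id
  | s + 1 => toMeromorphicNFOn (shiftExtension (fun z ↦ Complex.exp (logGamma (s + 1) (z - 1)))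
      (multipleGamma s)) Set.univ

/-- `H` is an extension of `exp (logGamma s (z - 1))` with poles and zeros only at the
non-positive integers. -/
structure IsGammaExtension (s : ℕ) (H : ℂ → ℂ) : Prop where
  meromorphicNFOn : MeromorphicNFOn H Set.univ
  analyticAt : ∀ z ∈ offNonposInt, AnalyticAt ℂ H z
  ne_zero : ∀ z ∈ offNonposInt, H z ≠ 0
  eq_exp : ∀ z : ℂ, 0 < z.re → H z = Complex.exp (logGamma s (z - 1))

theorem isGammaExtension_id : IsGammaExtension 0 id where
  meromorphicNFOn _ _ := analyticAt_id.meromorphicNFAt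
  analyticAt _ _ := analyticAt_id
  ne_zero z hz h := hz 0 (by simpa using h)
  eq_exp z hz := by
    have : z ≠ 0 := by rintro rfl; simp at hz
    simp [logGamma, Complex.exp_log this]

theorem sub_one_mem_rightHalfPlane {z : ℂ} (hz : 0 < z.re) : z - 1 ∈ rightHalfPlane := by
  simp [rightHalfPlane]
  exact hz

theorem analyticAt_exp_logGamma (s : ℕ) {z : ℂ} (hz : 0 < z.re) :
    AnalyticAt ℂ (fun z ↦ Complex.exp (logGamma s (z - 1))) z := by
  refine AnalyticAt.cexp ?_
  exact AnalyticAt.fun_comp (g := logGamma s)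
    ((isLogGammaLike_logGamma s).differentiableOn.analyticAt (isOpen_rightHalfPlane.mem_nhds (sub_one_mem_rightHalfPlane hz)))
    (analyticAt_id.sub analyticAt_const)

theorem toMeromorphicNFOn_apply_of_analyticAt {f : ℂ → ℂ} (hf : MeromorphicOn f Set.univ) {z : ℂ}
    (hz : AnalyticAt ℂ f z) : toMeromorphicNFOn f Set.univ z = f z := by
  rw [toMeromorphicNFOn_eq_toMeromorphicNFAt hf (Set.mem_univ z),
    toMeromorphicNFAt_eq_self.2 hz.meromorphicNFAt]

/-- Since H has no zeros or poles off the non-positive integers, dividing by its shifts creates none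
there. Normalisation leaves values at analytic points unchanged, so the functional equation
survives. -/
theorem IsGammaExtension.succ {s : ℕ} {H : ℂ → ℂ} (hH : IsGammaExtension s H) :
    IsGammaExtension (s + 1) (toMeromorphicNFOn (shiftExtension
      (fun z ↦ Complex.exp (logGamma (s + 1) (z - 1))) H) Set.univ) ∧
    ∀ z ∈ offNonposInt, toMeromorphicNFOn (shiftExtension
      (fun z ↦ Complex.exp (logGamma (s + 1) (z - 1))) H) Set.univ (z + 1) =
      H z * toMeromorphicNFOn (shiftExtension
      (fun z ↦ Complex.exp (logGamma (s + 1) (z - 1))) H) Set.univ z := by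
  set F : ℂ → ℂ := fun z ↦ Complex.exp (logGamma (s + 1) (z - 1)) with hFdef
  have hF : ∀ z, 0 < z.re → F (z + 1) = H z * F z := fun z hz ↦ by
    change Complex.exp (logGamma (s + 1) (z + 1 - 1)) =
      H z * Complex.exp (logGamma (s + 1) (z - 1))
    rw [hH.eq_exp z hz, ← Complex.exp_add, ← logGamma_add_one, sub_add_cancel,
      add_sub_cancel_right]
  have hFa : ∀ z : ℂ, 0 < z.re → AnalyticAt ℂ F z := fun z hz ↦ analyticAt_exp_logGamma (s + 1) hz
  have hm : MeromorphicOn (shiftExtension F H) Set.univ := fun z _ ↦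
    meromorphicAt_shiftExtension hH.ne_zero hF hH.meromorphicNFOn.meromorphicOn hFa z
  have heq : ∀ z ∈ offNonposInt,
      toMeromorphicNFOn (shiftExtension F H) Set.univ z = shiftExtension F H z := fun z hz ↦
    toMeromorphicNFOn_apply_of_analyticAt hm
      (analyticAt_shiftExtension hH.ne_zero hF hH.analyticAt hFa hz)
  have hNF : MeromorphicNFOn (toMeromorphicNFOn (shiftExtension F H) Set.univ) Set.univ :=
    meromorphicNFOn_toMeromorphicNFOn _ _
  have hne : ∀ z ∈ offNonposInt, toMeromorphicNFOn (shiftExtension F H) Set.univ z ≠ 0 := by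
    intro z hz
    obtain ⟨m, hm⟩ := exists_nat_re_add_pos z
    rw [heq z hz, shiftExtension_eq hH.ne_zero hF hz hm]
    exact div_ne_zero (Complex.exp_ne_zero _) (prod_ne_zero_of_mem_offNonposInt hH.ne_zero hz m)
  refine ⟨⟨hNF, fun z hz ↦ (hNF (Set.mem_univ z)).analyticAt_of_ne_zero (hne z hz), hne,
    fun z hz ↦ ?_⟩, fun z hz ↦ ?_⟩
  · have hz' := mem_offNonposInt_of_re_pos hz
    rw [heq z hz', shiftExtension_eq hH.ne_zero hF hz' (m := 0) (by simpa using hz)]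
    simp [shiftQuotient, hFdef]
  · rw [heq z hz, heq _ (by simpa using add_natCast_mem_offNonposInt hz 1),
      shiftExtension_add_one hH.ne_zero hF hz]

theorem isGammaExtension_multipleGamma (s : ℕ) : IsGammaExtension s (multipleGamma s) := by
  induction s with
  | zero => exact isGammaExtension_id
  | succ s ih => exact ih.succ.1

theorem multipleGamma_add_one (s : ℕ) {z : ℂ} (hz : z ∈ offNonposInt) :
    multipleGamma (s + 1) (z + 1) = multipleGamma s z * multipleGamma (s + 1) z :=
  (isGammaExtension_multipleGamma s).succ.2 z hz

theorem multipleGamma_apply_add_one (s : ℕ) {z : ℂ} (hz : z ∈ rightHalfPlane) :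
    multipleGamma s (z + 1) = Complex.exp (logGamma s z) := by
  have h := (isGammaExtension_multipleGamma s).eq_exp (z + 1) (by
    simp only [rightHalfPlane, Set.mem_ofPred_eq] at hz
    simp
    linarith)
  rwa [add_sub_cancel_right] at h

theorem logGamma_ofReal (s : ℕ) {x : ℝ} (hx : -1 < x) :
    logGamma s x = ((logGamma s x).re : ℂ) :=
  Complex.ext rfl (by rw [(isRealAlternating_logGamma s).im_eq_zero x hx, Complex.ofReal_im])

theorem multipleGamma_ofReal_add_one (s : ℕ) {x : ℝ} (hx : -1 < x) :
    multipleGamma s (x + 1) = (Real.exp (logGamma s x).re : ℂ) := by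
  rw [multipleGamma_apply_add_one s (ofReal_mem_rightHalfPlane.2 hx), logGamma_ofReal s hx,
    Complex.ofReal_re, Complex.ofReal_exp]

theorem isMultipleGammaSeq_multipleGamma : IsMultipleGammaSeq multipleGamma where
  meromorphic r := (isGammaExtension_multipleGamma r).meromorphicNFOn
  zero _ := rfl
  one r := by
    have h := multipleGamma_ofReal_add_one r (x := 0) (by norm_num)
    simpa [logGamma_apply_zero] using h
  functional_eq r := by
    filter_upwards [offNonposInt_mem_codiscrete] with z hz using multipleGamma_add_one r hz
  pos r x hx := by
    rw [multipleGamma_ofReal_add_one r (by linarith)]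
    exact ⟨by rw [Complex.ofReal_re]; exact Real.exp_pos _, Complex.ofReal_im _⟩
  iteratedDeriv_log_nonneg r x hx := by
    have hx1 : -1 < x := by linarith
    have h : (fun t : ℝ ↦ Real.log (multipleGamma r (t + 1)).re) =ᶠ[𝓝 x]
        fun t ↦ (logGamma r t).re := by
      filter_upwards [lt_mem_nhds hx1] with t ht
      rw [multipleGamma_ofReal_add_one r ht, Complex.ofReal_re, Real.log_exp]
    rw [h.iteratedDeriv_eq]
    exact iteratedDeriv_logGamma_nonneg r hx1

/-! ### The Gauss and Euler products -/

theorem ofReal_exp_cpow (a : ℝ) (c : ℂ) : (Real.exp a : ℂ) ^ c = Complex.exp (c * a) := by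
  rw [Complex.cpow_def_of_ne_zero (by exact_mod_cast (Real.exp_pos a).ne'),
    ← Complex.ofReal_log (Real.exp_pos a).le, Real.log_exp, mul_comm]

theorem multipleGamma_natCast_add_one (k N : ℕ) :
    multipleGamma k ((N : ℂ) + 1) = (Real.exp (logGamma k N).re : ℂ) := by
  have hN : (0 : ℝ) ≤ N := N.cast_nonneg
  simpa using multipleGamma_ofReal_add_one k (x := N) (by linarith)

theorem logGamma_natCast (k N : ℕ) : ((logGamma k N).re : ℂ) = logGamma k N := by
  have hN : (0 : ℝ) ≤ N := N.cast_nonneg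
  simpa using (logGamma_ofReal k (x := N) (by linarith)).symm

theorem multipleGamma_natCast_add_one_cpow (k N : ℕ) (c : ℂ) :
    multipleGamma k ((N : ℂ) + 1) ^ c = Complex.exp (c * logGamma k N) := by
  rw [multipleGamma_natCast_add_one, ofReal_exp_cpow, logGamma_natCast]

theorem multipleGamma_div_cpow (k N : ℕ) (c : ℂ) :
    (multipleGamma k ((N : ℂ) + 1 + 1) / multipleGamma k ((N : ℂ) + 1)) ^ c *
      multipleGamma k ((N : ℂ) + 1) ^ c = multipleGamma k ((N : ℂ) + 1 + 1) ^ c := by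
  have h := multipleGamma_natCast_add_one k (N + 1)
  rw [Nat.cast_succ] at h
  rw [h, multipleGamma_natCast_add_one, ← Complex.ofReal_div, ← Real.exp_sub, ofReal_exp_cpow,
    ofReal_exp_cpow, ofReal_exp_cpow, ← Complex.exp_add]
  push_cast
  ring_nf

/-- Differencing level r exactly r - k times gives level k; reversing the sum matches the exponents
of the product. -/
theorem newtonRem_logGamma (r N : ℕ) (z : ℂ) :
    newtonRem (logGamma r) r N z = logGamma r (z + N) - logGamma r N -
      ∑ k ∈ Finset.range r, Ring.choose z (r - k) * logGamma k N := by
  have h (k : ℕ) (hk : k ∈ Finset.range (r + 1)) :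
      Ring.choose z (r - k) * (fwdDiff 1)^[r - k] (logGamma r) (N : ℂ) =
        Ring.choose z (r - k) * logGamma k N := by
    have e := fwdDiff_iterate_logGamma k (r - k)
    rw [Nat.add_sub_cancel' (Nat.lt_succ_iff.1 (Finset.mem_range.1 hk))] at e
    rw [e]
  rw [newtonRem, ← Finset.sum_range_reflect]
  simp only [Nat.add_sub_cancel]
  rw [Finset.sum_congr rfl h, Finset.sum_range_succ, Nat.sub_self, Ring.choose_zero_right]
  ring

theorem multipleGamma_add_natCast (s N : ℕ) {z : ℂ} (hz : z ∈ offNegInt) :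
    multipleGamma (s + 1) (z + N + 1) =
      multipleGamma (s + 1) (z + 1) * ∏ n ∈ Finset.Icc 1 N, multipleGamma s (z + n) := by
  induction N with
  | zero => simp
  | succ N ih =>
    have h := add_natCast_mem_offNonposInt (add_one_mem_offNonposInt_iff.2 hz) N
    rw [add_right_comm] at h
    rw [Finset.prod_Icc_succ_top (by omega), ← mul_assoc, ← ih, mul_comm, Nat.cast_succ,
      ← add_assoc, multipleGamma_add_one s h]

theorem multipleGamma_natCast_eq_prod (s N : ℕ) :
    multipleGamma (s + 1) (N + 1) = ∏ n ∈ Finset.Icc 1 N, multipleGamma s n := by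
  have h := multipleGamma_add_natCast s N (z := 0)
    (add_one_mem_offNonposInt_iff.1 (mem_offNonposInt_of_re_pos (by simp)))
  simpa only [zero_add, isMultipleGammaSeq_multipleGamma.one, one_mul] using h

theorem multipleGamma_add_one_ne_zero (s : ℕ) {z : ℂ} (hz : z ∈ offNegInt) :
    multipleGamma s (z + 1) ≠ 0 :=
  (isGammaExtension_multipleGamma s).ne_zero _ (add_one_mem_offNonposInt_iff.2 hz)

/-- The functional equation turns the finite product into G(z + N + 1) / G(z + 1), and only z + N
need lie where the logarithm is available. The remaining exponents form the Newton sum. -/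
theorem gaussTerm_multipleGamma (s N : ℕ) {z : ℂ} (hz : z ∈ offNegInt)
    (hzN : z + N ∈ rightHalfPlane) :
    gaussTerm multipleGamma (s + 1) N z = multipleGamma (s + 1) (z + 1) *
      Complex.exp (-newtonRem (logGamma (s + 1)) (s + 1) N z) := by
  have h1 := multipleGamma_add_natCast s N hz
  rw [multipleGamma_apply_add_one _ hzN] at h1
  have h2 := multipleGamma_add_one_ne_zero (s + 1) hz
  have h3 : ∏ n ∈ Finset.Icc 1 N, multipleGamma s (z + n) ≠ 0 := fun h ↦
    Complex.exp_ne_zero _ (h1.trans (by rw [h, mul_zero]))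
  rw [gaussTerm, Nat.add_sub_cancel, Finset.prod_div_distrib, ← multipleGamma_natCast_eq_prod]
  simp only [multipleGamma_natCast_add_one_cpow]
  rw [← Complex.exp_sum, multipleGamma_natCast_add_one, Complex.ofReal_exp, logGamma_natCast,
    newtonRem_logGamma, neg_sub, Complex.exp_sub, Complex.exp_sub, h1]
  field_simp

theorem gaussTerm_zero (r : ℕ) (z : ℂ) : gaussTerm multipleGamma r 0 z = 1 := by
  simp [gaussTerm, isMultipleGammaSeq_multipleGamma.one]

theorem gaussTerm_succ (r N : ℕ) (z : ℂ) :
    gaussTerm multipleGamma r (N + 1) z =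
      gaussTerm multipleGamma r N z * eulerFactor multipleGamma r (N + 1) z := by
  rw [gaussTerm, gaussTerm, eulerFactor, Finset.prod_Icc_succ_top (by omega)]
  push_cast
  simp only [← multipleGamma_div_cpow, Finset.prod_mul_distrib]
  ring

theorem prod_eulerFactor (r N : ℕ) (z : ℂ) :
    ∏ n ∈ Finset.range N, eulerFactor multipleGamma r (n + 1) z =
      gaussTerm multipleGamma r N z := by
  induction N with
  | zero => simp [gaussTerm_zero]
  | succ N ih => rw [Finset.prod_range_succ, ih, gaussTerm_succ]

/-- An Euler factor is a ratio of consecutive Gauss terms, so its exponent is minus an increment of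
remainders at level s + 1, that is, minus a remainder at level s. -/
theorem eulerFactor_multipleGamma (s n : ℕ) {z : ℂ} (hz : z ∈ offNegInt)
    (hzn : z + n ∈ rightHalfPlane) :
    eulerFactor multipleGamma (s + 1) (n + 1) z =
      Complex.exp (-newtonRem (logGamma s) (s + 1) n z) := by
  have hzn' : z + (n + 1 : ℕ) ∈ rightHalfPlane := by
    have := add_natCast_mem_rightHalfPlane hzn 1
    push_cast at this ⊢
    rwa [← add_assoc]
  have h1 := gaussTerm_succ (s + 1) n z
  have h2 := multipleGamma_add_one_ne_zero (s + 1) hz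
  rw [gaussTerm_multipleGamma s _ hz hzn, gaussTerm_multipleGamma s _ hz hzn'] at h1
  have h3 : newtonRem (logGamma s) (s + 1) n z = newtonRem (logGamma (s + 1)) (s + 1) (n + 1) z -
      newtonRem (logGamma (s + 1)) (s + 1) n z := by
    rw [← newtonRem_fwdDiff, fwdDiff_logGamma]
  rw [mul_assoc] at h1
  have h4 := mul_left_cancel₀ h2 h1
  refine mul_left_cancel₀ (Complex.exp_ne_zero _) (h4.symm.trans ?_)
  rw [h3, ← Complex.exp_add]
  ring_nf

theorem eventually_add_natCast_mem_rightHalfPlane (R : ℝ) :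
    ∀ᶠ n : ℕ in atTop, ∀ z : ℂ, ‖z‖ ≤ R → z + n ∈ rightHalfPlane := by
  obtain ⟨N, hN⟩ := exists_nat_ge R
  filter_upwards [eventually_ge_atTop N] with n hn z hz
  have h1 := (abs_le.1 (Complex.abs_re_le_norm z)).1
  have h2 : (N : ℝ) ≤ n := by exact_mod_cast hn
  simp only [rightHalfPlane, Set.mem_ofPred_eq, Complex.add_re, Complex.natCast_re]
  linarith

theorem tendsto_gaussTerm (s : ℕ) {z : ℂ} (hz : z ∈ offNegInt) :
    Tendsto (fun N ↦ gaussTerm multipleGamma (s + 1) N z) atTop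
      (𝓝 (multipleGamma (s + 1) (z + 1))) := by
  have h := ((isLogGammaLike_logGamma (s + 1)).tendsto_newtonRem le_rfl z).neg.cexp.const_mul
    (multipleGamma (s + 1) (z + 1))
  rw [neg_zero, Complex.exp_zero, mul_one] at h
  refine h.congr' ?_
  filter_upwards [eventually_add_natCast_mem_rightHalfPlane ‖z‖] with N hN
  exact (gaussTerm_multipleGamma s N hz (hN z le_rfl)).symm

theorem continuousOn_eulerFactor (s n : ℕ) :
    ContinuousOn (fun z ↦ eulerFactor multipleGamma (s + 1) (n + 1) z) offNegInt := by
  intro z hz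
  refine ContinuousAt.continuousWithinAt ?_
  have hz' : z + (n + 1 : ℕ) ∈ offNonposInt := by
    have h := add_natCast_mem_offNonposInt (add_one_mem_offNonposInt_iff.2 hz) n
    push_cast
    rwa [add_right_comm, add_assoc] at h
  have hG := isGammaExtension_multipleGamma s
  refine ContinuousAt.mul (ContinuousAt.div continuousAt_const ?_ (hG.ne_zero _ hz'))
    (tendsto_finsetProd _ fun k _ ↦ ?_)
  · exact ContinuousAt.comp (g := multipleGamma s) (hG.analyticAt _ hz').continuousAt
      (continuousAt_id.add continuousAt_const)
  · refine ((continuous_ringChoose _).continuousAt).const_cpow (Or.inl ?_)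
    have hne (m : ℕ) : multipleGamma k ((m : ℂ) + 1) ≠ 0 := by
      rw [multipleGamma_natCast_add_one]
      exact_mod_cast (Real.exp_pos _).ne'
    refine div_ne_zero (hne _) ?_
    push_cast
    exact hne n

theorem exists_norm_eulerFactor_sub_one_le (s : ℕ) {K : Set ℂ} (hK : K ⊆ offNegInt)
    (hKc : IsCompact K) : ∃ u : ℕ → ℝ, Summable u ∧
      ∀ᶠ n in atTop, ∀ z ∈ K, ‖eulerFactor multipleGamma (s + 1) (n + 1) z - 1‖ ≤ u n := by
  obtain ⟨R, hR⟩ := hKc.isBounded.exists_norm_le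
  obtain ⟨u, hu, h⟩ := (isLogGammaLike_logGamma s).exists_norm_newtonRem_le R
  refine ⟨_, hu.mul_left 2, ?_⟩
  filter_upwards [h, eventually_add_natCast_mem_rightHalfPlane R,
    hu.tendsto_atTop_zero.eventually_le_const one_pos] with n h1 h2 h3 z hz
  have h4 := h1 z (hR z hz)
  rw [eulerFactor_multipleGamma s n (hK hz) (h2 z (hR z hz))]
  refine (Complex.norm_exp_sub_one_le ?_).trans ?_
  · rw [norm_neg]
    exact h4.trans h3
  · rw [norm_neg]
    linarith

/-- The summable majorant gives convergence in any order; the limit is identified along initial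
segments, whose products are the Gauss terms. -/
theorem hasProdLocallyUniformlyOn_eulerFactor (s : ℕ) :
    HasProdLocallyUniformlyOn (fun n z ↦ eulerFactor multipleGamma (s + 1) (n + 1) z)
      (fun z ↦ multipleGamma (s + 1) (z + 1)) offNegInt := by
  have h : HasProdLocallyUniformlyOn
      (fun n z ↦ eulerFactor multipleGamma (s + 1) (n + 1) z)
      (fun z ↦ ∏' n, eulerFactor multipleGamma (s + 1) (n + 1) z) offNegInt := by
    refine hasProdLocallyUniformlyOn_of_forall_compact isOpen_offNegInt fun K hK hKc ↦ ?_
    obtain ⟨u, hu, hle⟩ := exists_norm_eulerFactor_sub_one_le s hK hKc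
    simpa only [add_sub_cancel] using Summable.hasProdUniformlyOn_nat_one_add hKc hu hle
      fun n ↦ ((continuousOn_eulerFactor s n).mono hK).sub continuousOn_const
  rw [hasProdLocallyUniformlyOn_iff_tendstoLocallyUniformlyOn] at h ⊢
  refine h.congr_right fun z hz ↦ ?_
  rw [← hasProdLocallyUniformlyOn_iff_tendstoLocallyUniformlyOn] at h
  have h1 := (h.hasProd hz).tendsto_prod_nat
  simp only [prod_eulerFactor] at h1
  exact tendsto_nhds_unique h1 (tendsto_gaussTerm s hz)

theorem tendstoLocallyUniformlyOn_gaussTerm (s : ℕ) :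
    TendstoLocallyUniformlyOn (fun N z ↦ gaussTerm multipleGamma (s + 1) N z)
      (fun z ↦ multipleGamma (s + 1) (z + 1)) atTop offNegInt := by
  simpa only [prod_eulerFactor] using
    (hasProdLocallyUniformlyOn_eulerFactor s).tendstoLocallyUniformlyOn_finsetRange

/-! ### The case r = 1 and the main theorem -/

theorem prod_Icc_one_id (N : ℕ) : ∏ n ∈ Finset.Icc 1 N, n = N.factorial := by
  induction N with
  | zero => rfl
  | succ N ih => rw [Finset.prod_Icc_succ_top (by omega), ih, Nat.factorial_succ, mul_comm]

theorem IsMultipleGammaSeq.gaussTerm_one {G : ℕ → ℂ → ℂ} (hG : IsMultipleGammaSeq G) (N : ℕ)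
    (z : ℂ) : gaussTerm G 1 N z =
      (Nat.factorial N : ℂ) / (∏ n ∈ Finset.Icc 1 N, (z + n)) * ((N : ℂ) + 1) ^ z := by
  simp only [gaussTerm, Nat.sub_self, hG.zero, Finset.range_one, Finset.prod_singleton,
    Nat.sub_zero, Ring.choose_one_right, Finset.prod_div_distrib]
  rw [← Nat.cast_prod, prod_Icc_one_id]

theorem IsMultipleGammaSeq.eulerFactor_one {G : ℕ → ℂ → ℂ} (hG : IsMultipleGammaSeq G) {n : ℕ}
    (hn : 1 ≤ n) (z : ℂ) : eulerFactor G 1 n z = (1 + z / n)⁻¹ * (1 + 1 / (n : ℂ)) ^ z := by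
  have hn0 : (n : ℂ) ≠ 0 := by exact_mod_cast (by omega : n ≠ 0)
  simp only [eulerFactor, Nat.sub_self, hG.zero, Finset.range_one, Finset.prod_singleton,
    Nat.sub_zero, Ring.choose_one_right]
  rw [add_div, div_self hn0, one_add_div (a := z) hn0, inv_div, add_comm z]

theorem meromorphicNFOn_Gamma : MeromorphicNFOn Complex.Gamma Set.univ := by
  rw [← meromorphicNFOn_inv]
  exact fun z _ ↦ (Complex.differentiable_one_div_Gamma.analyticAt z).meromorphicNFAt

theorem multipleGamma_one : multipleGamma 1 = Complex.Gamma := by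
  refine ((isGammaExtension_multipleGamma 1).meromorphicNFOn).eq_of_eqOn_Ioi
    meromorphicNFOn_Gamma (a := 1) fun x hx ↦ ?_
  obtain ⟨y, hy, rfl⟩ : ∃ y : ℝ, 0 < y ∧ x = y + 1 := ⟨x - 1, by linarith, by ring⟩
  have hy0 : (y : ℂ) ≠ 0 := by exact_mod_cast hy.ne'
  have hmem : (y : ℂ) ∈ offNegInt := add_one_mem_offNonposInt_iff.1
    (mem_offNonposInt_of_re_pos (by simp; linarith))
  have h1 := tendsto_gaussTerm 0 hmem
  -- `Complex.GammaSeq` uses N^y instead of (N + 1)^y; this factor bridges the two.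
  have h2 : Tendsto (fun N : ℕ ↦ (1 + 1 / (N : ℂ)) ^ (y : ℂ)) atTop (𝓝 1) := by
    have h : Tendsto (fun N : ℕ ↦ 1 + 1 / (N : ℂ)) atTop (𝓝 (1 + 0)) :=
      tendsto_one_div_atTop_nhds_zero_nat.const_add 1
    rw [add_zero] at h
    simpa using h.cpow (tendsto_const_nhds (x := (y : ℂ))) Complex.one_mem_slitPlane
  have h3 := ((Complex.GammaSeq_tendsto_Gamma y).const_mul (y : ℂ)).mul h2
  rw [mul_one, ← Complex.Gamma_add_one _ hy0] at h3
  push_cast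
  refine tendsto_nhds_unique (h1.congr' ?_) h3
  filter_upwards [eventually_ge_atTop 1] with N hN
  have hN0 : (N : ℂ) ≠ 0 := by exact_mod_cast (by omega : N ≠ 0)
  have h4 : ((N : ℂ) + 1) ^ (y : ℂ) = (N : ℂ) ^ (y : ℂ) * (1 + 1 / (N : ℂ)) ^ (y : ℂ) := by
    have h := Complex.mul_cpow_ofReal_nonneg (a := N) (b := 1 + 1 / N) (by positivity)
      (by positivity) (y : ℂ)
    push_cast at h
    rw [← h, mul_add, mul_one, mul_one_div_cancel hN0]
  have h5 : ∏ j ∈ Finset.range (N + 1), ((y : ℂ) + j) =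
      (∏ n ∈ Finset.Icc 1 N, ((y : ℂ) + n)) * y := by
    rw [Finset.prod_range_succ', Nat.cast_zero, add_zero, Finset.range_eq_Ico,
      Finset.prod_Ico_add' (fun j : ℕ ↦ (y : ℂ) + j)]
    rfl
  rw [isMultipleGammaSeq_multipleGamma.gaussTerm_one, h4, Complex.GammaSeq, h5]
  field_simp

theorem theorem1 :
    (∃! G : ℕ → ℂ → ℂ, IsMultipleGammaSeq G) ∧
    ∀ G : ℕ → ℂ → ℂ, IsMultipleGammaSeq G →
      (∀ r : ℕ, 1 ≤ r →
        (∀ z ∈ offNegInt,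
          Tendsto (fun N : ℕ ↦ gaussTerm G r N z) atTop (𝓝 (G r (z + 1))) ∧
          HasProd (fun n : ℕ ↦ eulerFactor G r (n + 1) z) (G r (z + 1))) ∧
        TendstoLocallyUniformlyOn (fun (N : ℕ) (z : ℂ) ↦ gaussTerm G r N z)
          (fun z ↦ G r (z + 1)) atTop offNegInt ∧
        HasProdLocallyUniformlyOn (fun (n : ℕ) (z : ℂ) ↦ eulerFactor G r (n + 1) z)
          (fun z ↦ G r (z + 1)) offNegInt) ∧
      G 1 = Complex.Gamma ∧
      (∀ z ∈ offNegInt, ∀ N : ℕ,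
        gaussTerm G 1 N z =
          (Nat.factorial N : ℂ) / (∏ n ∈ Finset.Icc 1 N, (z + n)) * ((N : ℂ) + 1) ^ z) ∧
      (∀ z ∈ offNegInt, ∀ n : ℕ, 1 ≤ n →
        eulerFactor G 1 n z = (1 + z / n)⁻¹ * (1 + 1 / (n : ℂ)) ^ z) := by
  refine ⟨⟨multipleGamma, isMultipleGammaSeq_multipleGamma,
    fun G hG ↦ hG.unique isMultipleGammaSeq_multipleGamma⟩, fun G hG ↦ ⟨fun r hr ↦ ?_, ?_,
    fun z _ N ↦ hG.gaussTerm_one N z, fun z _ n hn ↦ hG.eulerFactor_one hn z⟩⟩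
  · obtain rfl := hG.unique isMultipleGammaSeq_multipleGamma
    obtain ⟨s, rfl⟩ : ∃ s, r = s + 1 := ⟨r - 1, by omega⟩
    exact ⟨fun z hz ↦ ⟨tendsto_gaussTerm s hz,
      (hasProdLocallyUniformlyOn_eulerFactor s).hasProd hz⟩,
      tendstoLocallyUniformlyOn_gaussTerm s, hasProdLocallyUniformlyOn_eulerFactor s⟩
  · rw [hG.unique isMultipleGammaSeq_multipleGamma, multipleGamma_one]
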